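/- Let $q$ be the order of a finite field $\mathbb{F}_q$ with $q \ge 43$, and let $\mathrm{PG}(3,q)$ be the projective $3$-space whose points, lines and planes are the subspaces of dimension $1$, $2$ and $3$ of a $4$-dimensional vector space over $\mathbb{F}_q$, with incidence given by inclusion. A chamber is a triple $(P,\ell,\pi)$ consisting of a point $P$, a line $\ell$ and a plane $\pi$ that are mutually incident. Two chambers $(P,\ell,\pi)$ and $(P',\ell',\pi')$ are opposite (in general position) if $P \notin \pi'$, $P' \notin \pi$, and the lines $\ell$ and $\ell'$ are skew. Let $\Gamma$ be the graph whose vertices are the chambers of $\mathrm{PG}(3,q)$, two being adjacent if and only if they are opposite. For a point or plane $x$, let $F(x)$ be the set of all chambers whose line is incident with $x$. Then: (a) The independent sets of $\Gamma$ of largest cardinality are exactly the sets $F(x)$, where $x$ is a point or a plane. (b) Every independent set of $\Gamma$ that is maximal with respect to inclusion and is not of the form $F(x)$ for a point or plane $x$ has at most $9(q+1)(5q^2+1)$ elements. (c) If $q \ge 47$, then the chromatic number of $\Gamma$ is $q^2+q$. -/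

import Mathlib

/-! The projective 3-space `PG(3,q)`: its points, lines and planes are the subspaces of
dimension 1, 2 and 3 of a 4-dimensional vector space over the field with `q` elements, and
incidence is (symmetrized) inclusion. -/

namespace PG3

variable {K V : Type*} [Field K] [AddCommGroup V] [Module K V]

/-- Points: 1-dimensional subspaces. -/
def IsPoint (x : Submodule K V) : Prop := Module.finrank K x = 1

/-- Lines: 2-dimensional subspaces. -/
def IsLine (x : Submodule K V) : Prop := Module.finrank K x = 2

/-- Planes: 3-dimensional subspaces. -/
def IsPlane (x : Submodule K V) : Prop := Module.finrank K x = 3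

/-- Two subspaces are incident if one of them contains the other. -/
def Incident (x y : Submodule K V) : Prop := x ≤ y ∨ y ≤ x

variable (K V) in
/-- A chamber: a point, a line and a plane that are mutually incident. -/
@[ext]
structure Chamber where
  point : Submodule K V
  line : Submodule K V
  plane : Submodule K V
  isPoint : IsPoint point
  isLine : IsLine line
  isPlane : IsPlane plane
  point_le_line : point ≤ line
  line_le_plane : line ≤ plane

instance [Finite K] [Module.Finite K V] : Finite (Chamber K V) := by
  have : Finite V := Module.finite_of_finite K
  refine Finite.of_injective
    (fun c : Chamber K V => (c.point, c.line, c.plane)) ?_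
  intro c d h
  simp only [Prod.mk.injEq] at h
  exact Chamber.ext h.1 h.2.1 h.2.2

/-- Two chambers are opposite (in general position) if neither point lies in the plane of the
other chamber and the two lines are skew, that is, have no common point. -/
def Opposite (c d : Chamber K V) : Prop :=
  ¬ c.point ≤ d.plane ∧ Disjoint c.line d.line ∧ ¬ d.point ≤ c.plane

variable (K V) in
/-- The graph on the chambers in which two chambers are adjacent if they are opposite. -/
def chamberGraph : SimpleGraph (Chamber K V) where
  Adj c d := Opposite c d
  symm := ⟨fun _ _ h => ⟨h.2.2, h.2.1.symm, h.1⟩⟩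
  loopless := ⟨fun c h => h.1 (c.point_le_line.trans c.line_le_plane)⟩

/-- `F x`: the set of all chambers whose line is incident with `x`. -/
def F (x : Submodule K V) : Set (Chamber K V) := {c | Incident x c.line}

end PG3

/-!
The proof separates an independent set `M` of chambers according to the lines of its chambers. The
basic observation is that, for skew lines `ℓ` and `ℓ'`, a plane through `ℓ'` contains only one point
of `ℓ`, and dually, so that chambers of `M` on `ℓ` strongly restrict those on `ℓ'`.

Suppose that the lines of `M` are neither concurrent nor coplanar; for maximal `M` this means that
`M` is not of the form `F x`. Lines of `M` that meet all lines of `M` then belong to one pencil, so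
there are at most `q + 1` of them. Each other line carries at most `2 * (q + 1)` chambers of `M`.
Two lines that both carry two chambers of `M` with the same point must meet, and pairwise
intersecting lines are concurrent or coplanar; hence there are at most `q ^ 2 + q + 1` such lines,
and dually for chambers sharing the plane. Every remaining line carries at most two chambers of `M`.
For these remaining chambers, there are at most `q ^ 2 + q + 1` with a given point or plane, and all
but `O(q ^ 3)` of the chambers not opposite to a given one are not opposite because of an incident
point-plane pair. The expander mixing inequality for the point-plane incidence graph
(`ProjectiveSpace.sum_incident_le`) shows that their number is about `4 * q ^ 3` at most
(`ProjectiveSpace.card_scattered_le`). In total, `#M ≤ 10 * q ^ 2 * (q + 1)`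
(`ProjectiveSpace.card_le_of_independent`), which is less than the cardinality
`(q ^ 2 + q + 1) * (q + 1) ^ 2` of `F x` and than the bound claimed.

For the chromatic number, let `m` be a line in a plane `ε`. The points of `ε` not on `m` and the
planes other than `ε` through `m` form a set of `q ^ 2 + q` elements such that every line is
incident with one of them, which gives a colouring. Conversely, given fewer colours, extend the
colour classes to maximal independent sets. Let `A` and `B` be the sets of points and planes `x`
for which `F x` occurs. Chambers whose lines are not covered by `A` and `B` belong to small classes,
so there are few uncovered lines. This contradicts `ProjectiveSpace.lt_card_uncovered`: averaging
over planes and over points the number of uncovered lines, compared with the number of incident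
elements of `A` or `B`, shows that `q ^ 2 + q - 1 - s` points and planes leave more than
`10 * q ^ 2 * s / (q + 1)` lines uncovered.

The incidence geometry is developed for a self-dual structure `ProjectiveSpace`, so that points and
planes can be interchanged.
-/

/-! ### Incidence geometry of projective 3-space -/

namespace PG3

section Abstract

open Finset
open scoped Classical

/-- The incidence structure of points, lines and planes of a projective 3-space of order `q`.
The axioms are redundant, but each of them comes with its dual, so that interchanging points and
planes gives such a structure again. -/
structure ProjectiveSpace (q : ℕ) (Pt Ln Pl : Type*) [Fintype Pt] [Fintype Ln] [Fintype Pl] where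
  /-- the point is on the line -/
  on : Pt → Ln → Prop
  /-- the line lies in the plane -/
  lies : Ln → Pl → Prop
  /-- the point is in the plane -/
  mem : Pt → Pl → Prop
  mem_of_on : ∀ {P ℓ π}, on P ℓ → lies ℓ π → mem P π
  card_points : Fintype.card Pt = (q + 1) * (q ^ 2 + 1)
  card_planes : Fintype.card Pl = (q + 1) * (q ^ 2 + 1)
  card_lines_on : ∀ P, #{ℓ | on P ℓ} = q ^ 2 + q + 1
  card_lines_in : ∀ π, #{ℓ | lies ℓ π} = q ^ 2 + q + 1
  card_points_on : ∀ ℓ, #{P | on P ℓ} = q + 1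
  card_planes_on : ∀ ℓ, #{π | lies ℓ π} = q + 1
  card_points_in : ∀ π, #{P | mem P π} = q ^ 2 + q + 1
  card_planes_through : ∀ P, #{π | mem P π} = q ^ 2 + q + 1
  card_pencil : ∀ {P π}, mem P π → #{ℓ | on P ℓ ∧ lies ℓ π} = q + 1
  card_planes_pair : ∀ {P P'}, P ≠ P' → #{π | mem P π ∧ mem P' π} = q + 1
  card_points_pair : ∀ {π π'}, π ≠ π' → #{P | mem P π ∧ mem P π'} = q + 1
  exists_join : ∀ {P P'}, P ≠ P' → ∃ ℓ, on P ℓ ∧ on P' ℓ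
  exists_inter : ∀ {π π'}, π ≠ π' → ∃ ℓ, lies ℓ π ∧ lies ℓ π'
  lies_of_two : ∀ {P P' ℓ π}, P ≠ P' → on P ℓ → on P' ℓ → mem P π → mem P' π → lies ℓ π
  on_of_two : ∀ {P ℓ π π'}, π ≠ π' → lies ℓ π → lies ℓ π' → mem P π → mem P π' → on P ℓ
  join_unique : ∀ {P P' ℓ ℓ'}, P ≠ P' → on P ℓ → on P' ℓ → on P ℓ' → on P' ℓ' → ℓ = ℓ'
  inter_unique : ∀ {π π' ℓ ℓ'}, π ≠ π' → lies ℓ π → lies ℓ π' → lies ℓ' π → lies ℓ' π' → ℓ = ℓ'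
  meet_iff : ∀ {ℓ ℓ'}, (∃ P, on P ℓ ∧ on P ℓ') ↔ ∃ π, lies ℓ π ∧ lies ℓ' π
  exists_plane : ∀ P ℓ, ∃ π, mem P π ∧ lies ℓ π
  exists_point : ∀ π ℓ, ∃ P, mem P π ∧ on P ℓ

namespace ProjectiveSpace

variable {q : ℕ} {Pt Ln Pl : Type*} [Fintype Pt] [Fintype Ln] [Fintype Pl]

/-- The dual space: points and planes are interchanged. -/
def dual (G : ProjectiveSpace q Pt Ln Pl) : ProjectiveSpace q Pl Ln Pt where
  on π ℓ := G.lies ℓ π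
  lies ℓ P := G.on P ℓ
  mem π P := G.mem P π
  mem_of_on h h' := G.mem_of_on h' h
  card_points := G.card_planes
  card_planes := G.card_points
  card_lines_on := G.card_lines_in
  card_lines_in := G.card_lines_on
  card_points_on := G.card_planes_on
  card_planes_on := G.card_points_on
  card_points_in := G.card_planes_through
  card_planes_through := G.card_points_in
  card_pencil h := by simpa only [and_comm] using G.card_pencil h
  card_planes_pair := G.card_points_pair
  card_points_pair := G.card_planes_pair
  exists_join := G.exists_inter
  exists_inter := G.exists_join
  lies_of_two := G.on_of_two
  on_of_two := G.lies_of_two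
  join_unique := G.inter_unique
  inter_unique := G.join_unique
  meet_iff := G.meet_iff.symm
  exists_plane := G.exists_point
  exists_point := G.exists_plane

/-- Two lines (possibly equal) have a common point. -/
def Meet (G : ProjectiveSpace q Pt Ln Pl) (ℓ ℓ' : Ln) : Prop := ∃ P, G.on P ℓ ∧ G.on P ℓ'

variable {G : ProjectiveSpace q Pt Ln Pl}

lemma dual_meet {ℓ ℓ' : Ln} : G.dual.Meet ℓ ℓ' ↔ G.Meet ℓ ℓ' := G.meet_iff.symm

lemma Meet.symm {ℓ ℓ' : Ln} (h : G.Meet ℓ ℓ') : G.Meet ℓ' ℓ :=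
  let ⟨P, h, h'⟩ := h
  ⟨P, h', h⟩

/-- A plane through one of two skew lines contains at most one point of the other. -/
lemma point_unique_of_skew {ℓ ℓ' : Ln} {π' : Pl} {P P' : Pt} (h : ¬ G.Meet ℓ ℓ')
    (hπ : G.lies ℓ' π') (hP : G.on P ℓ) (hP' : G.on P' ℓ) (h1 : G.mem P π') (h2 : G.mem P' π') :
    P = P' := by
  by_contra hne
  exact h (G.meet_iff.2 ⟨π', G.lies_of_two hne hP hP' h1 h2, hπ⟩)

/-- A point on one of two skew lines is in at most one plane through the other. -/
lemma plane_unique_of_skew {ℓ ℓ' : Ln} {P' : Pt} {π π' : Pl} (h : ¬ G.Meet ℓ ℓ')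
    (hP : G.on P' ℓ') (hπ : G.lies ℓ π) (hπ' : G.lies ℓ π') (h1 : G.mem P' π) (h2 : G.mem P' π') :
    π = π' :=
  G.dual.point_unique_of_skew (fun hm => h (dual_meet.1 hm)) hP hπ hπ' h1 h2

variable (G)

lemma nonempty_on (ℓ : Ln) : ∃ P, G.on P ℓ := by
  have h : 0 < #{P | G.on P ℓ} := by rw [G.card_points_on]; omega
  obtain ⟨P, hP⟩ := card_pos.1 h
  exact ⟨P, by simpa using hP⟩

lemma nonempty_points (G : ProjectiveSpace q Pt Ln Pl) : Nonempty Pt :=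
  Fintype.card_pos_iff.1 (by rw [G.card_points]; positivity)

lemma concurrent_or_coplanar_of_ne {L : Finset Ln} {ℓ₁ ℓ₂ : Ln} (h₁ : ℓ₁ ∈ L) (h₂ : ℓ₂ ∈ L)
    (hne : ℓ₁ ≠ ℓ₂) (hL : ∀ ℓ ∈ L, ∀ ℓ' ∈ L, G.Meet ℓ ℓ') :
    (∃ P, ∀ ℓ ∈ L, G.on P ℓ) ∨ ∃ π, ∀ ℓ ∈ L, G.lies ℓ π := by
  obtain ⟨P, hP₁, hP₂⟩ := hL _ h₁ _ h₂
  obtain ⟨π, hπ₁, hπ₂⟩ := G.meet_iff.1 (hL _ h₁ _ h₂)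
  by_contra! hcon
  obtain ⟨ℓ₃, h₃, hP₃⟩ := hcon.1 P
  have only : ∀ {X}, G.on X ℓ₁ → G.on X ℓ₂ → X = P := fun hX₁ hX₂ => by
    by_contra hX
    exact hne (G.join_unique hX hX₁ hP₁ hX₂ hP₂)
  have hπ₃ : G.lies ℓ₃ π := by
    obtain ⟨X, hX₁, hX₃⟩ := hL _ h₁ _ h₃
    obtain ⟨Y, hY₂, hY₃⟩ := hL _ h₂ _ h₃
    refine G.lies_of_two (P := X) (P' := Y) ?_ hX₃ hY₃ (G.mem_of_on hX₁ hπ₁) (G.mem_of_on hY₂ hπ₂)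
    rintro rfl
    exact hP₃ (only hX₁ hY₂ ▸ hX₃)
  obtain ⟨ℓ₄, h₄, hπ₄⟩ := hcon.2 π
  obtain ⟨X, hX₁, hX₄⟩ := hL _ h₁ _ h₄
  obtain ⟨Y, hY₂, hY₄⟩ := hL _ h₂ _ h₄
  obtain ⟨Z, hZ₃, hZ₄⟩ := hL _ h₃ _ h₄
  have same : ∀ {A B}, G.on A ℓ₄ → G.on B ℓ₄ → G.mem A π → G.mem B π → A = B :=
    fun hA hB hA' hB' => by
      by_contra hAB
      exact hπ₄ (G.lies_of_two hAB hA hB hA' hB')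
  obtain rfl := same hX₄ hY₄ (G.mem_of_on hX₁ hπ₁) (G.mem_of_on hY₂ hπ₂)
  obtain rfl := same hX₄ hZ₄ (G.mem_of_on hX₁ hπ₁) (G.mem_of_on hZ₃ hπ₃)
  exact hP₃ (only hX₁ hY₂ ▸ hZ₃)

/-- Pairwise intersecting lines are concurrent or coplanar. -/
lemma concurrent_or_coplanar {L : Finset Ln} (hL : ∀ ℓ ∈ L, ∀ ℓ' ∈ L, G.Meet ℓ ℓ') :
    (∃ P, ∀ ℓ ∈ L, G.on P ℓ) ∨ ∃ π, ∀ ℓ ∈ L, G.lies ℓ π := by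
  by_cases hne : ∃ ℓ₁ ∈ L, ∃ ℓ₂ ∈ L, ℓ₁ ≠ ℓ₂
  · obtain ⟨ℓ₁, h₁, ℓ₂, h₂, hne⟩ := hne
    exact G.concurrent_or_coplanar_of_ne h₁ h₂ hne hL
  push Not at hne
  rcases L.eq_empty_or_nonempty with rfl | ⟨ℓ, hℓ⟩
  · exact Or.inl (G.nonempty_points.elim fun P => ⟨P, by simp⟩)
  · obtain ⟨P, hP⟩ := G.nonempty_on ℓ
    exact Or.inl ⟨P, fun ℓ' h' => hne _ hℓ _ h' ▸ hP⟩

lemma card_le_of_pairwise_meet {L : Finset Ln} (hL : ∀ ℓ ∈ L, ∀ ℓ' ∈ L, G.Meet ℓ ℓ') :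
    #L ≤ q ^ 2 + q + 1 := by
  rcases G.concurrent_or_coplanar hL with ⟨P, hP⟩ | ⟨π, hπ⟩
  · rw [← G.card_lines_on P]
    exact card_le_card fun ℓ hℓ => by simpa using hP ℓ hℓ
  · rw [← G.card_lines_in π]
    exact card_le_card fun ℓ hℓ => by simpa using hπ ℓ hℓ

lemma card_le_of_concurrent_transversal {H : Finset Ln} {P : Pt} {ℓ₁ : Ln}
    (hP : ∀ ℓ ∈ H, G.on P ℓ) (h₁ : ¬ G.on P ℓ₁) (hm : ∀ ℓ ∈ H, G.Meet ℓ ℓ₁) : #H ≤ q + 1 := by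
  obtain ⟨π, hPπ, hπ⟩ := G.exists_plane P ℓ₁
  rw [← G.card_pencil hPπ]
  refine card_le_card fun ℓ hℓ => ?_
  obtain ⟨X, hX, hX₁⟩ := hm ℓ hℓ
  have hne : P ≠ X := by
    rintro rfl
    exact h₁ hX₁
  simpa using ⟨hP ℓ hℓ, G.lies_of_two hne (hP ℓ hℓ) hX hPπ (G.mem_of_on hX₁ hπ)⟩

/-- If the lines of `L` are neither concurrent nor coplanar, then at most `q + 1` of them meet
all lines of `L`: these lines belong to a single pencil. -/
lemma card_universal_le {L H : Finset Ln} (hHL : H ⊆ L) (hH : ∀ ℓ ∈ H, ∀ ℓ' ∈ L, G.Meet ℓ ℓ')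
    (hpt : ∀ P, ∃ ℓ ∈ L, ¬ G.on P ℓ) (hpl : ∀ π, ∃ ℓ ∈ L, ¬ G.lies ℓ π) : #H ≤ q + 1 := by
  rcases G.concurrent_or_coplanar fun ℓ h ℓ' h' => hH ℓ h ℓ' (hHL h') with ⟨P, hP⟩ | ⟨π, hπ⟩
  · obtain ⟨ℓ₁, h₁, h₁'⟩ := hpt P
    exact G.card_le_of_concurrent_transversal hP h₁' fun ℓ h => hH ℓ h _ h₁
  · obtain ⟨ℓ₁, h₁, h₁'⟩ := hpl π
    exact G.dual.card_le_of_concurrent_transversal hπ h₁' fun ℓ h => dual_meet.2 (hH ℓ h _ h₁)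

/-- The number of lines meeting a given line, counted crudely. -/
lemma card_meet_le (ℓ : Ln) : #{ℓ' | G.Meet ℓ ℓ'} ≤ (q + 1) * (q ^ 2 + q + 1) := by
  have hsub : ({ℓ' | G.Meet ℓ ℓ'} : Finset Ln) ⊆
      ({P | G.on P ℓ} : Finset Pt).biUnion fun P => {ℓ' | G.on P ℓ'} := by
    intro ℓ' h
    obtain ⟨P, hP, hP'⟩ := (mem_filter.1 h).2
    exact mem_biUnion.2 ⟨P, by simpa using hP, by simpa using hP'⟩
  refine (card_le_card hsub).trans ?_
  rw [← G.card_points_on ℓ]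
  exact card_biUnion_le_card_mul _ _ _ fun P _ => (G.card_lines_on P).le

/-! ### Expander mixing for points and planes -/

lemma sum_sum_mem (f : Pt → ℝ) : ∑ π, ∑ P with G.mem P π, f P = (q ^ 2 + q + 1) * ∑ P, f P := by
  simp_rw [sum_filter]
  rw [sum_comm, mul_sum]
  refine sum_congr rfl fun P _ => ?_
  rw [← sum_filter, sum_const, G.card_planes_through, nsmul_eq_mul]
  push_cast
  rfl

/-- The identity `N * Nᵀ = q ^ 2 + (q + 1) * J` for the point-plane incidence matrix `N` and the
all-one matrix `J`, as an identity of quadratic forms. -/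
lemma sum_sq_sum_mem (f : Pt → ℝ) :
    ∑ π, (∑ P with G.mem P π, f P) ^ 2 = q ^ 2 * ∑ P, f P ^ 2 + (q + 1) * (∑ P, f P) ^ 2 := by
  have h1 : ∀ π, (∑ P with G.mem P π, f P) ^ 2 =
      ∑ P, ∑ P', if G.mem P π ∧ G.mem P' π then f P * f P' else 0 := by
    intro π
    simp_rw [sq, sum_mul_sum, sum_filter, ite_and]
    refine sum_congr rfl fun P _ => ?_
    split_ifs <;> simp
  have h2 : ∀ P P', (∑ π, if G.mem P π ∧ G.mem P' π then f P * f P' else 0) =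
      (q + 1) * (f P * f P') + if P = P' then (q : ℝ) ^ 2 * f P ^ 2 else 0 := by
    intro P P'
    rw [← sum_filter, sum_const, nsmul_eq_mul]
    split_ifs with h
    · subst h
      simp only [and_self, G.card_planes_through]
      push_cast
      ring
    · rw [G.card_planes_pair h]
      push_cast
      ring
  simp_rw [h1]
  rw [sum_comm]
  simp_rw [sum_comm (s := (univ : Finset Pl)), h2, sum_add_distrib]
  simp only [sum_ite_eq, mem_univ, if_true]
  rw [sq (∑ P, f P), sum_mul_sum, mul_sum, mul_sum, add_comm]
  simp_rw [mul_sum]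

/-- Expander mixing for the incidence graph of points and planes: for weights `f` on the points
and `g` on the planes of the same total weight `σ`, the weighted number of incident pairs exceeds
its expected value by at most `q` times the mean of `∑ f ^ 2` and `∑ g ^ 2`.
The nontrivial singular values of the incidence matrix are all equal to `q`. -/
lemma sum_incident_le (f : Pt → ℝ) (g : Pl → ℝ) (σ : ℝ) (hf : ∑ P, f P = σ) (hg : ∑ π, g π = σ)
    (hq : 0 < q) :
    ∑ π, g π * ∑ P with G.mem P π, f P ≤
      σ ^ 2 * (q ^ 2 + q + 1) / ((q + 1) * (q ^ 2 + 1)) +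
        q / 2 * (∑ P, f P ^ 2 + ∑ π, g π ^ 2) := by
  have hq' : (0 : ℝ) < q := by exact_mod_cast hq
  set A : Pl → ℝ := fun π => ∑ P with G.mem P π, f P with hA
  set N : ℝ := (q + 1) * (q ^ 2 + 1) with hN
  have hNpos : 0 < N := by positivity
  set k : ℝ := σ * (q ^ 2 + q + 1) / N with hk
  have hkN : k * N = σ * (q ^ 2 + q + 1) := by rw [hk]; field_simp
  -- `k` is the mean of `A`, so this bounds its variance
  have hvar : ∑ π, (A π - k) ^ 2 ≤ q ^ 2 * ∑ P, f P ^ 2 := by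
    have hexp : ∑ π, (A π - k) ^ 2 = ∑ π, A π ^ 2 - 2 * k * ∑ π, A π + N * k ^ 2 := by
      simp_rw [sub_sq, sum_add_distrib, sum_sub_distrib, sum_const, card_univ, G.card_planes,
        nsmul_eq_mul, mul_sum]
      push_cast
      congr 2
      exact sum_congr rfl fun π _ => by ring
    rw [hexp, G.sum_sq_sum_mem, G.sum_sum_mem, hf]
    have : (q + 1) * σ ^ 2 - 2 * k * ((q ^ 2 + q + 1) * σ) + N * k ^ 2 ≤ 0 := by
      refine le_of_mul_le_mul_left ?_ hNpos
      have : N * ((q + 1) * σ ^ 2 - 2 * k * ((q ^ 2 + q + 1) * σ) + N * k ^ 2) =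
          -(q ^ 2 * σ ^ 2) := by
        linear_combination (N * k - σ * (q ^ 2 + q + 1)) * hkN + (q + 1) * σ ^ 2 * hN
      rw [this]
      nlinarith [sq_nonneg (q * σ)]
    linarith
  have hpt : ∀ π, g π * A π ≤ k * g π + ((A π - k) ^ 2 / (2 * q) + q / 2 * g π ^ 2) := by
    intro π
    have h0 : 0 ≤ (A π - k - q * g π) ^ 2 / (2 * q) := by positivity
    have : (A π - k - q * g π) ^ 2 / (2 * q) =
        (A π - k) ^ 2 / (2 * q) + q / 2 * g π ^ 2 - g π * (A π - k) := by
      field_simp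
      ring
    linarith
  calc ∑ π, g π * A π
      ≤ ∑ π, (k * g π + ((A π - k) ^ 2 / (2 * q) + q / 2 * g π ^ 2)) := sum_le_sum fun π _ => hpt π
    _ = k * σ + ((∑ π, (A π - k) ^ 2) / (2 * q) + q / 2 * ∑ π, g π ^ 2) := by
      rw [sum_add_distrib, sum_add_distrib, ← mul_sum, ← mul_sum, hg, sum_div]
    _ ≤ k * σ + ((q ^ 2 * ∑ P, f P ^ 2) / (2 * q) + q / 2 * ∑ π, g π ^ 2) := by gcongr
    _ = _ := by
      rw [hk]
      field_simp

/-! ### Independent families of chambers -/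

section Families

variable {ι : Type*} {p : ι → Pt} {l : ι → Ln} {h : ι → Pl}

lemma card_filter_point_le {S : Finset ι} (hpl : ∀ i, G.on (p i) (l i))
    (hinj : ∀ i ∈ S, ∀ j ∈ S, l i = l j → p i = p j → i = j) (P : Pt) :
    #{i ∈ S | p i = P} ≤ q ^ 2 + q + 1 := by
  rw [← G.card_lines_on P]
  refine card_le_card_of_injOn l ?_ ?_
  · intro i hi
    have hi := (mem_filter.1 hi).2
    simpa using hi ▸ hpl i
  · intro i hi j hj hij
    have hi := mem_filter.1 hi
    have hj := mem_filter.1 hj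
    exact hinj i hi.1 j hj.1 hij (hi.2.trans hj.2.symm)

/-- Chambers `i ∈ S`, no two of which are opposite, such that each line belongs to at most two of
them, and two of them with the same line share neither the point nor the plane. Then `S` has
roughly `4 * q ^ 3` elements at most: a chamber of `S` is non-opposite to all but `O(q ^ 3)` others
by way of an incident point-plane pair, and expander mixing limits the number of such pairs. -/
lemma card_scattered_le {S : Finset ι} (hpl : ∀ i, G.on (p i) (l i))
    (hlh : ∀ i, G.lies (l i) (h i))
    (hp : ∀ i ∈ S, ∀ j ∈ S, l i = l j → p i = p j → i = j)
    (hh : ∀ i ∈ S, ∀ j ∈ S, l i = l j → h i = h j → i = j)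
    (htwo : ∀ ℓ, #{i ∈ S | l i = ℓ} ≤ 2)
    (hind : ∀ i ∈ S, ∀ j ∈ S, G.mem (p i) (h j) ∨ G.mem (p j) (h i) ∨ G.Meet (l i) (l j))
    (hq : 2 < q) :
    #S * (q - 2) ≤ (4 * q + 2) * ((q + 1) * (q ^ 2 + 1)) := by
  have hmeet : ∀ i, #{j ∈ S | G.Meet (l i) (l j)} ≤ (q + 1) * (q ^ 2 + q + 1) * 2 := by
    intro i
    have hsub : ({j ∈ S | G.Meet (l i) (l j)} : Finset ι) ⊆
        ({ℓ' | G.Meet (l i) ℓ'} : Finset Ln).biUnion fun ℓ' => {j ∈ S | l j = ℓ'} := by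
      intro j hj
      have hj := mem_filter.1 hj
      exact mem_biUnion.2 ⟨l j, by simpa using hj.2, by simpa using hj.1⟩
    refine (card_le_card hsub).trans ((card_biUnion_le_card_mul _ _ _ fun ℓ' _ => htwo ℓ').trans ?_)
    gcongr
    exact G.card_meet_le (l i)
  set f : Pt → ℝ := fun P => #{i ∈ S | p i = P} with hf
  set g : Pl → ℝ := fun π => #{i ∈ S | h i = π} with hg
  have hfT : ∀ P, f P ≤ q ^ 2 + q + 1 := fun P => by
    have := (Nat.cast_le (α := ℝ)).2 (G.card_filter_point_le hpl hp P)
    push_cast at this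
    exact this
  have hgT : ∀ π, g π ≤ q ^ 2 + q + 1 := fun π => by
    have := (Nat.cast_le (α := ℝ)).2 (G.dual.card_filter_point_le hlh hh π)
    push_cast at this
    exact this
  have hfS : ∑ P, f P = #S := by
    rw [card_eq_sum_card_fiberwise (f := p) (t := univ) (s := S) (fun _ _ => by simp)]
    push_cast
    rfl
  have hgS : ∑ π, g π = #S := by
    rw [card_eq_sum_card_fiberwise (f := h) (t := univ) (s := S) (fun _ _ => by simp)]
    push_cast
    rfl
  have hf2 : ∑ P, f P ^ 2 ≤ (q ^ 2 + q + 1) * #S := by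
    rw [← hfS, mul_sum]
    refine sum_le_sum fun P _ => ?_
    rw [sq]
    exact mul_le_mul_of_nonneg_right (hfT P) (Nat.cast_nonneg _)
  have hg2 : ∑ π, g π ^ 2 ≤ (q ^ 2 + q + 1) * #S := by
    rw [← hgS, mul_sum]
    refine sum_le_sum fun π _ => ?_
    rw [sq]
    exact mul_le_mul_of_nonneg_right (hgT π) (Nat.cast_nonneg _)
  have hE : ∑ π, g π * ∑ P with G.mem P π, f P =
      ∑ j ∈ S, (#{i ∈ S | G.mem (p i) (h j)} : ℝ) := by
    have h1 : ∀ π, ∑ P with G.mem P π, f P = (#{i ∈ S | G.mem (p i) π} : ℝ) := by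
      intro π
      have := card_eq_sum_card_fiberwise (s := {i ∈ S | G.mem (p i) π}) (f := p)
        (t := {P | G.mem P π}) (fun i hi => by
          have := (mem_filter.1 hi).2
          simpa using this)
      rw [this]
      push_cast
      refine sum_congr rfl fun P hP => ?_
      have hP := (mem_filter.1 hP).2
      have heq : ({i ∈ S | p i = P} : Finset ι) = {i ∈ S | G.mem (p i) π ∧ p i = P} := by
        refine filter_congr fun i _ => ⟨?_, fun h => h.2⟩
        rintro rfl
        exact ⟨hP, rfl⟩
      simp only [hf, filter_filter, heq]
    simp_rw [h1]
    rw [← sum_fiberwise S h]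
    refine sum_congr rfl fun π _ => ?_
    rw [hg, ← nsmul_eq_mul, ← sum_const]
    refine sum_congr rfl fun j hj => ?_
    rw [(mem_filter.1 hj).2]
  have hpairs : (#S : ℝ) * #S ≤ #S * ((q + 1) * (q ^ 2 + q + 1) * 2) +
      2 * ∑ j ∈ S, (#{i ∈ S | G.mem (p i) (h j)} : ℝ) := by
    have hswap : ∑ j ∈ S, #{i ∈ S | G.mem (p i) (h j)} = ∑ i ∈ S, #{j ∈ S | G.mem (p i) (h j)} :=
      (sum_card_bipartiteAbove_eq_sum_card_bipartiteBelow fun i j => G.mem (p i) (h j)).symm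
    have hrow : ∀ i ∈ S, #S ≤ #{j ∈ S | G.mem (p i) (h j)} + #{j ∈ S | G.mem (p j) (h i)} +
        (q + 1) * (q ^ 2 + q + 1) * 2 := by
      intro i hi
      have hsub : S ⊆ ({j ∈ S | G.mem (p i) (h j)} ∪ {j ∈ S | G.mem (p j) (h i)}) ∪
          {j ∈ S | G.Meet (l i) (l j)} := by
        intro j hj
        have := hind i hi j hj
        simp only [mem_union, mem_filter]
        tauto
      have h1 := card_le_card hsub
      have h2 := card_union_le ({j ∈ S | G.mem (p i) (h j)} ∪ {j ∈ S | G.mem (p j) (h i)})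
        {j ∈ S | G.Meet (l i) (l j)}
      have h3 := card_union_le {j ∈ S | G.mem (p i) (h j)} {j ∈ S | G.mem (p j) (h i)}
      have h4 := hmeet i
      omega
    have hsum := sum_le_sum hrow
    rw [sum_const, sum_add_distrib, sum_add_distrib, sum_const, ← hswap, smul_eq_mul,
      smul_eq_mul] at hsum
    have hcast : ((#S * #S : ℕ) : ℝ) ≤ _ := Nat.cast_le.2 hsum
    push_cast at hcast
    linarith
  rw [← hE] at hpairs
  have hmix := G.sum_incident_le f g #S hfS hgS (by omega)
  set E := ∑ π, g π * ∑ P with G.mem P π, f P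
  rcases S.eq_empty_or_nonempty with rfl | hne
  · simp
  have hσ : (0 : ℝ) < #S := by exact_mod_cast hne.card_pos
  generalize (#S : ℕ) = σ at *
  obtain ⟨r, rfl⟩ := Nat.exists_eq_add_of_lt hq
  have hN : (0 : ℝ) < (((2 + r + 1 : ℕ) : ℝ) + 1) * (((2 + r + 1 : ℕ) : ℝ) ^ 2 + 1) := by positivity
  set Q : ℝ := ((2 + r + 1 : ℕ) : ℝ) with hQ
  have hQr : Q = r + 3 := by rw [hQ]; push_cast; ring
  have hr : (0 : ℝ) ≤ r := Nat.cast_nonneg r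
  have hE2 : E ≤ σ ^ 2 * (Q ^ 2 + Q + 1) / ((Q + 1) * (Q ^ 2 + 1)) +
      Q * ((Q ^ 2 + Q + 1) * σ) := by nlinarith
  have hratio : σ ^ 2 * (Q ^ 2 + Q + 1) / ((Q + 1) * (Q ^ 2 + 1)) ≤ (σ : ℝ) ^ 2 / Q := by
    rw [div_le_div_iff₀ hN (by linarith)]
    nlinarith [sq_nonneg (σ : ℝ)]
  have hmain : (σ : ℝ) * σ ≤ σ * ((4 * Q + 2) * (Q ^ 2 + Q + 1)) + 2 * (σ ^ 2 / Q) := by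
    linarith
  have h5 : (σ : ℝ) * (Q - 2) ≤ (4 * Q + 2) * ((Q + 1) * (Q ^ 2 + 1)) := by
    have hQ0 : 0 < Q := by linarith
    have h6 : (σ : ℝ) * (σ * (Q - 2)) ≤ σ * ((4 * Q + 2) * (Q ^ 2 + Q + 1) * Q) := by
      have : 2 * ((σ : ℝ) ^ 2 / Q) * Q = 2 * σ ^ 2 := by field_simp
      nlinarith
    have h7 := le_of_mul_le_mul_left h6 hσ
    nlinarith
  have h8 : ((σ * (r + 1) : ℕ) : ℝ) ≤
      (((4 * (2 + r + 1) + 2) * ((2 + r + 1 + 1) * ((2 + r + 1) ^ 2 + 1)) : ℕ) : ℝ) := by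
    push_cast
    rw [hQr] at h5
    convert h5 using 1 <;> ring
  rw [show 2 + r + 1 - 2 = r + 1 by omega]
  exact_mod_cast h8

lemma card_fiber_le_sq {M : Finset ι} (hpl : ∀ i, G.on (p i) (l i)) (hlh : ∀ i, G.lies (l i) (h i))
    (hinj : ∀ i ∈ M, ∀ j ∈ M, p i = p j → l i = l j → h i = h j → i = j) (ℓ : Ln) :
    #{i ∈ M | l i = ℓ} ≤ (q + 1) * (q + 1) := by
  have hcard := card_product {P | G.on P ℓ} {π | G.lies ℓ π}
  rw [G.card_points_on, G.card_planes_on] at hcard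
  rw [← hcard]
  refine card_le_card_of_injOn (fun i => (p i, h i)) ?_ ?_
  · intro i hi
    have hi := (mem_filter.1 hi).2
    simpa using ⟨hi ▸ hpl i, hi ▸ hlh i⟩
  · intro i hi j hj hij
    have hi := mem_filter.1 hi
    have hj := mem_filter.1 hj
    simp only [Prod.mk.injEq] at hij
    exact hinj i hi.1 j hj.1 hij.1 (hi.2.trans hj.2.symm) hij.2

lemma card_fiber_mem_le {M : Finset ι} (hpl : ∀ i, G.on (p i) (l i))
    (hlh : ∀ i, G.lies (l i) (h i))
    (hinj : ∀ i ∈ M, ∀ j ∈ M, p i = p j → l i = l j → h i = h j → i = j) {ℓ : Ln} {k : ι}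
    (hk : ¬ G.Meet ℓ (l k)) :
    #{i ∈ M | l i = ℓ ∧ G.mem (p i) (h k)} ≤ q + 1 := by
  rw [← G.card_planes_on ℓ]
  refine card_le_card_of_injOn h ?_ ?_
  · intro i hi
    have hi := (mem_filter.1 hi).2.1
    simpa using hi ▸ hlh i
  · intro i hi j hj hij
    have hi := mem_filter.1 hi
    have hj := mem_filter.1 hj
    refine hinj i hi.1 j hj.1 ?_ (hi.2.1.trans hj.2.1.symm) hij
    exact point_unique_of_skew hk (hlh k) (hi.2.1 ▸ hpl i) (hj.2.1 ▸ hpl j) hi.2.2 hj.2.2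

lemma card_fiber_le {M : Finset ι} (hpl : ∀ i, G.on (p i) (l i)) (hlh : ∀ i, G.lies (l i) (h i))
    (hinj : ∀ i ∈ M, ∀ j ∈ M, p i = p j → l i = l j → h i = h j → i = j)
    (hind : ∀ i ∈ M, ∀ j ∈ M, G.mem (p i) (h j) ∨ G.mem (p j) (h i) ∨ G.Meet (l i) (l j))
    {ℓ : Ln} {k : ι} (hkM : k ∈ M) (hk : ¬ G.Meet ℓ (l k)) :
    #{i ∈ M | l i = ℓ} ≤ 2 * (q + 1) := by
  have h1 := G.card_fiber_mem_le hpl hlh hinj hk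
  have h2 : #{i ∈ M | l i = ℓ ∧ G.mem (p k) (h i)} ≤ q + 1 :=
    G.dual.card_fiber_mem_le hlh hpl (fun i hi j hj a b c => hinj i hi j hj c b a)
      fun hm => hk (dual_meet.1 hm)
  have hsub : ({i ∈ M | l i = ℓ} : Finset ι) ⊆
      {i ∈ M | l i = ℓ ∧ G.mem (p i) (h k)} ∪ {i ∈ M | l i = ℓ ∧ G.mem (p k) (h i)} := by
    intro i hi
    have hi := mem_filter.1 hi
    rcases hind i hi.1 k hkM with hm | hm | hm
    · exact mem_union_left _ (mem_filter.2 ⟨hi.1, hi.2, hm⟩)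
    · exact mem_union_right _ (mem_filter.2 ⟨hi.1, hi.2, hm⟩)
    · exact absurd (hi.2 ▸ hm) hk
  have h3 := (card_le_card hsub).trans (card_union_le _ _)
  omega

/-- Two lines, each of which carries two chambers of an independent set with the same point, meet.
If they were skew, then at most one of the two planes at either line would contain the point chosen
on the other one, which leaves an opposite pair. -/
lemma meet_of_shared_points {M : Finset ι} (hpl : ∀ i, G.on (p i) (l i))
    (hlh : ∀ i, G.lies (l i) (h i))
    (hinj : ∀ i ∈ M, ∀ j ∈ M, p i = p j → l i = l j → h i = h j → i = j)
    (hind : ∀ i ∈ M, ∀ j ∈ M, G.mem (p i) (h j) ∨ G.mem (p j) (h i) ∨ G.Meet (l i) (l j))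
    {i j i' j' : ι} (hi : i ∈ M) (hj : j ∈ M) (hi' : i' ∈ M) (hj' : j' ∈ M) (hij : i ≠ j)
    (hij' : i' ≠ j') (hl : l i = l j) (hl' : l i' = l j') (hp : p i = p j) (hp' : p i' = p j') :
    G.Meet (l i) (l i') := by
  by_contra hm
  have a1 : ¬ (G.mem (p i') (h i) ∧ G.mem (p i') (h j)) := fun hc =>
    hij (hinj i hi j hj hp hl
      (plane_unique_of_skew hm (hpl i') (hlh i) (hl ▸ hlh j) hc.1 hc.2))
  have a2 : ¬ (G.mem (p i) (h i') ∧ G.mem (p i) (h j')) := fun hc =>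
    hij' (hinj i' hi' j' hj' hp' hl'
      (plane_unique_of_skew (fun h => hm h.symm) (hpl i) (hlh i') (hl' ▸ hlh j') hc.1 hc.2))
  have b1 := hind i hi i' hi'
  have b2 := hind i hi j' hj'
  have b3 := hind j hj i' hi'
  have b4 := hind j hj j' hj'
  rw [← hl, ← hl', ← hp, ← hp'] at b4
  rw [← hl', ← hp'] at b2
  rw [← hl, ← hp] at b3
  tauto

lemma card_shared_points_le {M : Finset ι} (hpl : ∀ i, G.on (p i) (l i))
    (hlh : ∀ i, G.lies (l i) (h i))
    (hinj : ∀ i ∈ M, ∀ j ∈ M, p i = p j → l i = l j → h i = h j → i = j)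
    (hind : ∀ i ∈ M, ∀ j ∈ M, G.mem (p i) (h j) ∨ G.mem (p j) (h i) ∨ G.Meet (l i) (l j)) :
    #{ℓ | ∃ i ∈ M, ∃ j ∈ M, i ≠ j ∧ l i = ℓ ∧ l j = ℓ ∧ p i = p j} ≤ q ^ 2 + q + 1 := by
  refine G.card_le_of_pairwise_meet ?_
  intro ℓ hℓ ℓ' hℓ'
  obtain ⟨i, hi, j, hj, hij, rfl, hl, hp⟩ := (mem_filter.1 hℓ).2
  obtain ⟨i', hi', j', hj', hij', rfl, hl', hp'⟩ := (mem_filter.1 hℓ').2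
  exact G.meet_of_shared_points hpl hlh hinj hind hi hj hi' hj' hij hij' hl.symm hl'.symm hp hp'

omit [Fintype Ln] in
lemma card_filter_line_mem_le {S : Finset ι} {L : Finset Ln} {c n : ℕ}
    (hL : #L ≤ n) (hc : ∀ ℓ ∈ L, #{i ∈ S | l i = ℓ} ≤ c) : #{i ∈ S | l i ∈ L} ≤ n * c := by
  have hsub : ({i ∈ S | l i ∈ L} : Finset ι) ⊆ L.biUnion fun ℓ => {i ∈ S | l i = ℓ} := by
    intro i hi
    have hi := mem_filter.1 hi
    exact mem_biUnion.2 ⟨l i, hi.2, mem_filter.2 ⟨hi.1, rfl⟩⟩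
  refine (card_le_card hsub).trans ((card_biUnion_le_card_mul _ _ _ hc).trans ?_)
  gcongr

/-- A family of pairwise non-opposite chambers whose lines are neither concurrent nor coplanar has
at most `10 * q ^ 2 * (q + 1)` elements. -/
theorem card_le_of_independent {M : Finset ι} (hpl : ∀ i, G.on (p i) (l i))
    (hlh : ∀ i, G.lies (l i) (h i))
    (hinj : ∀ i ∈ M, ∀ j ∈ M, p i = p j → l i = l j → h i = h j → i = j)
    (hind : ∀ i ∈ M, ∀ j ∈ M, G.mem (p i) (h j) ∨ G.mem (p j) (h i) ∨ G.Meet (l i) (l j))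
    (hpt : ∀ P, ∃ i ∈ M, ¬ G.on P (l i)) (hpn : ∀ π, ∃ i ∈ M, ¬ G.lies (l i) π) (hq : 43 ≤ q) :
    #M ≤ 10 * q ^ 2 * (q + 1) := by
  have hinj' : ∀ i ∈ M, ∀ j ∈ M, h i = h j → l i = l j → p i = p j → i = j :=
    fun i hi j hj a b c => hinj i hi j hj c b a
  have hind' : ∀ i ∈ M, ∀ j ∈ M,
      G.dual.mem (h i) (p j) ∨ G.dual.mem (h j) (p i) ∨ G.dual.Meet (l i) (l j) := by
    intro i hi j hj
    rw [dual_meet]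
    exact or_left_comm.1 (hind i hi j hj)
  -- lines meeting all lines of the family, lines with two chambers sharing the point, and lines
  -- with two chambers sharing the plane
  set H : Finset Ln := {ℓ ∈ M.image l | ∀ k ∈ M, G.Meet ℓ (l k)} with hH
  set R : Finset Ln := {ℓ | ∃ i ∈ M, ∃ j ∈ M, i ≠ j ∧ l i = ℓ ∧ l j = ℓ ∧ p i = p j} with hR
  set C : Finset Ln := {ℓ | ∃ i ∈ M, ∃ j ∈ M, i ≠ j ∧ l i = ℓ ∧ l j = ℓ ∧ h i = h j} with hC
  have hHcard : #H ≤ q + 1 := by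
    refine G.card_universal_le (L := M.image l) (filter_subset _ _) ?_ ?_ ?_
    · intro ℓ hℓ ℓ' hℓ'
      obtain ⟨k, hk, rfl⟩ := mem_image.1 hℓ'
      exact (mem_filter.1 hℓ).2 k hk
    · intro P
      obtain ⟨i, hi, hi'⟩ := hpt P
      exact ⟨l i, mem_image_of_mem l hi, hi'⟩
    · intro π
      obtain ⟨i, hi, hi'⟩ := hpn π
      exact ⟨l i, mem_image_of_mem l hi, hi'⟩
  have hRcard : #R ≤ q ^ 2 + q + 1 := G.card_shared_points_le hpl hlh hinj hind
  have hCcard : #C ≤ q ^ 2 + q + 1 := G.dual.card_shared_points_le hlh hpl hinj' hind'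
  set M' : Finset ι := {i ∈ M | l i ∉ H} with hM'
  have hskew : ∀ i ∈ M', ∃ k ∈ M, ¬ G.Meet (l i) (l k) := by
    intro i hi
    obtain ⟨hiM, hi⟩ := mem_filter.1 hi
    by_contra! hcon
    exact hi (mem_filter.2 ⟨mem_image_of_mem l hiM, hcon⟩)
  have hfib : ∀ ℓ, #{i ∈ M' | l i = ℓ} ≤ 2 * (q + 1) := by
    intro ℓ
    rcases ({i ∈ M' | l i = ℓ} : Finset ι).eq_empty_or_nonempty with he | ⟨i, hi⟩
    · simp [he]
    · obtain ⟨hi', rfl⟩ := mem_filter.1 hi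
      obtain ⟨k, hk, hik⟩ := hskew i hi'
      refine le_trans (card_le_card ?_) (G.card_fiber_le hpl hlh hinj hind hk hik)
      exact filter_subset_filter _ (filter_subset _ _)
  have hMH : #{i ∈ M | l i ∈ H} ≤ (q + 1) * ((q + 1) * (q + 1)) :=
    card_filter_line_mem_le hHcard fun ℓ _ => G.card_fiber_le_sq hpl hlh hinj ℓ
  have hMR : #{i ∈ M' | l i ∈ R} ≤ (q ^ 2 + q + 1) * (2 * (q + 1)) :=
    card_filter_line_mem_le hRcard fun ℓ _ => hfib ℓ
  have hMC : #{i ∈ M' | l i ∈ C} ≤ (q ^ 2 + q + 1) * (2 * (q + 1)) :=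
    card_filter_line_mem_le hCcard fun ℓ _ => hfib ℓ
  set S : Finset ι := {i ∈ M' | l i ∉ R ∧ l i ∉ C} with hS
  have hSM : ∀ i ∈ S, i ∈ M := fun i hi => (mem_filter.1 (mem_filter.1 hi).1).1
  have hSp : ∀ i ∈ S, ∀ j ∈ S, l i = l j → p i = p j → i = j := by
    intro i hi j hj hl hp
    by_contra hij
    exact (mem_filter.1 hi).2.1
      (mem_filter.2 ⟨mem_univ _, i, hSM i hi, j, hSM j hj, hij, rfl, hl.symm, hp⟩)
  have hSh : ∀ i ∈ S, ∀ j ∈ S, l i = l j → h i = h j → i = j := by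
    intro i hi j hj hl hh
    by_contra hij
    exact (mem_filter.1 hi).2.2
      (mem_filter.2 ⟨mem_univ _, i, hSM i hi, j, hSM j hj, hij, rfl, hl.symm, hh⟩)
  have hStwo : ∀ ℓ, #{i ∈ S | l i = ℓ} ≤ 2 := by
    intro ℓ
    rcases ({i ∈ S | l i = ℓ} : Finset ι).eq_empty_or_nonempty with he | ⟨i, hi⟩
    · simp [he]
    obtain ⟨hi', rfl⟩ := mem_filter.1 hi
    obtain ⟨k, hk, hik⟩ := hskew i (mem_filter.1 hi').1
    have hsub : ({j ∈ S | l j = l i} : Finset ι) ⊆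
        {j ∈ S | l j = l i ∧ G.mem (p j) (h k)} ∪ {j ∈ S | l j = l i ∧ G.mem (p k) (h j)} := by
      intro j hj
      obtain ⟨hj, hl⟩ := mem_filter.1 hj
      rcases hind j (hSM j hj) k hk with hm | hm | hm
      · exact mem_union_left _ (mem_filter.2 ⟨hj, hl, hm⟩)
      · exact mem_union_right _ (mem_filter.2 ⟨hj, hl, hm⟩)
      · exact absurd (hl ▸ hm) hik
    have h1 : #{j ∈ S | l j = l i ∧ G.mem (p j) (h k)} ≤ 1 := by
      refine card_le_one.2 fun a ha b hb => ?_
      obtain ⟨ha, hla, hma⟩ := mem_filter.1 ha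
      obtain ⟨hb, hlb, hmb⟩ := mem_filter.1 hb
      exact hSp a ha b hb (hla.trans hlb.symm)
        (point_unique_of_skew hik (hlh k) (hla ▸ hpl a) (hlb ▸ hpl b) hma hmb)
    have h2 : #{j ∈ S | l j = l i ∧ G.mem (p k) (h j)} ≤ 1 := by
      refine card_le_one.2 fun a ha b hb => ?_
      obtain ⟨ha, hla, hma⟩ := mem_filter.1 ha
      obtain ⟨hb, hlb, hmb⟩ := mem_filter.1 hb
      exact hSh a ha b hb (hla.trans hlb.symm)
        (plane_unique_of_skew hik (hpl k) (hla ▸ hlh a) (hlb ▸ hlh b) hma hmb)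
    have h3 := (card_le_card hsub).trans (card_union_le _ _)
    omega
  have hScard := G.card_scattered_le hpl hlh hSp hSh hStwo
    (fun i hi j hj => hind i (hSM i hi) j (hSM j hj)) (by omega)
  have htotal : #M ≤ #{i ∈ M | l i ∈ H} + (#{i ∈ M' | l i ∈ R} + #{i ∈ M' | l i ∈ C} + #S) := by
    have hsub : M ⊆ {i ∈ M | l i ∈ H} ∪ ({i ∈ M' | l i ∈ R} ∪ {i ∈ M' | l i ∈ C} ∪ S) := by
      intro i hi
      simp only [mem_union, hS, hM', mem_filter]
      tauto
    have h1 := (card_le_card hsub).trans (card_union_le _ _)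
    have h2 := card_union_le ({i ∈ M' | l i ∈ R} ∪ {i ∈ M' | l i ∈ C}) S
    have h3 := card_union_le {i ∈ M' | l i ∈ R} {i ∈ M' | l i ∈ C}
    omega
  obtain ⟨r, rfl⟩ := Nat.exists_eq_add_of_le hq
  rw [show 43 + r - 2 = 41 + r by omega] at hScard
  -- cancelling `q - 2` in `hScard`; the subtracted terms bound the chambers outside `S`
  have hfinal : #S ≤ 10 * (43 + r) ^ 2 * (43 + r + 1) - (43 + r + 1) * ((43 + r + 1) * (43 + r + 1))
      - 4 * (((43 + r) ^ 2 + (43 + r) + 1) * (43 + r + 1)) := by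
    refine Nat.le_of_mul_le_mul_right (hScard.trans ?_) (by omega : 0 < 41 + r)
    have hsub : 10 * (43 + r) ^ 2 * (43 + r + 1) - (43 + r + 1) * ((43 + r + 1) * (43 + r + 1))
        - 4 * (((43 + r) ^ 2 + (43 + r) + 1) * (43 + r + 1)) =
        5 * r ^ 3 + 644 * r ^ 2 + 27638 * r + 395208 := by
      rw [Nat.sub_sub]
      refine Nat.sub_eq_of_eq_add ?_
      ring
    rw [hsub]
    ring_nf
    nlinarith [Nat.zero_le (r ^ 3), Nat.zero_le (r ^ 2), Nat.zero_le r, Nat.zero_le (r ^ 4)]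
  have hle : (43 + r + 1) * ((43 + r + 1) * (43 + r + 1))
      + 4 * (((43 + r) ^ 2 + (43 + r) + 1) * (43 + r + 1)) ≤ 10 * (43 + r) ^ 2 * (43 + r + 1) := by
    ring_nf
    nlinarith [Nat.zero_le (r ^ 3), Nat.zero_le (r ^ 2), Nat.zero_le r]
  rw [Nat.sub_sub] at hfinal
  have h4 : #S + ((43 + r + 1) * ((43 + r + 1) * (43 + r + 1))
      + 4 * (((43 + r) ^ 2 + (43 + r) + 1) * (43 + r + 1))) ≤ 10 * (43 + r) ^ 2 * (43 + r + 1) := by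
    omega
  linarith

end Families

/-! ### Covering lines by points and planes -/

/-- The lines that contain no point of `A` and lie in no plane of `B`. -/
noncomputable def uncovered (A : Finset Pt) (B : Finset Pl) : Finset Ln :=
  {ℓ | (∀ P ∈ A, ¬ G.on P ℓ) ∧ ∀ π ∈ B, ¬ G.lies ℓ π}

lemma mem_uncovered {A : Finset Pt} {B : Finset Pl} {ℓ : Ln} :
    ℓ ∈ G.uncovered A B ↔ (∀ P ∈ A, ¬ G.on P ℓ) ∧ ∀ π ∈ B, ¬ G.lies ℓ π := by
  simp [uncovered]

lemma dual_uncovered (A : Finset Pt) (B : Finset Pl) : G.dual.uncovered B A = G.uncovered A B :=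
  filter_congr fun _ _ => and_comm

/-- A set of `k` points of a plane meets at most `q * k + 1` lines of the plane. -/
lemma card_lines_meeting_le (A : Finset Pt) (π : Pl) :
    #{ℓ | G.lies ℓ π ∧ ∃ P ∈ A, G.on P ℓ} ≤ q * #{P ∈ A | G.mem P π} + 1 := by
  rcases ({P ∈ A | G.mem P π} : Finset Pt).eq_empty_or_nonempty with he | ⟨P₀, hP₀⟩
  · have : ({ℓ | G.lies ℓ π ∧ ∃ P ∈ A, G.on P ℓ} : Finset Ln) = ∅ := by
      refine filter_eq_empty_iff.2 ?_
      rintro ℓ - ⟨hℓ, P, hP, hPℓ⟩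
      have : P ∈ ({P ∈ A | G.mem P π} : Finset Pt) := mem_filter.2 ⟨hP, G.mem_of_on hPℓ hℓ⟩
      simp [he] at this
    simp [this]
  set A' : Finset Pt := {P ∈ A | G.mem P π}
  have hP₀π : G.mem P₀ π := (mem_filter.1 hP₀).2
  have hsub : ({ℓ | G.lies ℓ π ∧ ∃ P ∈ A, G.on P ℓ} : Finset Ln) ⊆
      ({ℓ | G.on P₀ ℓ ∧ G.lies ℓ π} : Finset Ln) ∪
        (A'.erase P₀).biUnion fun P => {ℓ | (G.on P ℓ ∧ G.lies ℓ π) ∧ ¬ G.on P₀ ℓ} := by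
    intro ℓ hℓ
    obtain ⟨hℓ, P, hP, hPℓ⟩ := (mem_filter.1 hℓ).2
    by_cases h0 : G.on P₀ ℓ
    · exact mem_union_left _ (mem_filter.2 ⟨mem_univ _, h0, hℓ⟩)
    · refine mem_union_right _ (mem_biUnion.2 ⟨P, mem_erase.2 ⟨?_, ?_⟩, ?_⟩)
      · rintro rfl
        exact h0 hPℓ
      · exact mem_filter.2 ⟨hP, G.mem_of_on hPℓ hℓ⟩
      · exact mem_filter.2 ⟨mem_univ _, ⟨hPℓ, hℓ⟩, h0⟩
  have hP : ∀ P ∈ A'.erase P₀, #{ℓ | (G.on P ℓ ∧ G.lies ℓ π) ∧ ¬ G.on P₀ ℓ} ≤ q := by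
    intro P hP
    obtain ⟨hne, hP⟩ := mem_erase.1 hP
    have hPπ : G.mem P π := (mem_filter.1 hP).2
    obtain ⟨m, hm, hm₀⟩ := G.exists_join hne
    have hlt : #{ℓ | (G.on P ℓ ∧ G.lies ℓ π) ∧ ¬ G.on P₀ ℓ} < #{ℓ | G.on P ℓ ∧ G.lies ℓ π} := by
      refine card_lt_card ⟨fun ℓ hℓ => ?_, fun hc => ?_⟩
      · exact mem_filter.2 ⟨mem_univ _, (mem_filter.1 hℓ).2.1⟩
      · have := hc (mem_filter.2 ⟨mem_univ m, hm, G.lies_of_two hne hm hm₀ hPπ hP₀π⟩)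
        exact (mem_filter.1 this).2.2 hm₀
    rw [G.card_pencil hPπ] at hlt
    omega
  have h1 := (card_le_card hsub).trans (card_union_le _ _)
  have h2 := card_biUnion_le_card_mul _ _ _ hP
  rw [G.card_pencil hP₀π] at h1
  have h3 := card_erase_add_one hP₀
  rw [← h3]
  linarith

/-- Each plane outside `B` contains many uncovered lines, unless it contains many points of `A`. -/
lemma le_card_uncovered_in (A : Finset Pt) (B : Finset Pl) {π : Pl} (hπ : π ∉ B) :
    q ^ 2 + q ≤ q * #{P ∈ A | G.mem P π} + #B + #{ℓ ∈ G.uncovered A B | G.lies ℓ π} := by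
  have hsub : ({ℓ | G.lies ℓ π} : Finset Ln) ⊆ ({ℓ | G.lies ℓ π ∧ ∃ P ∈ A, G.on P ℓ} : Finset Ln) ∪
      (B.biUnion fun β => {ℓ | G.lies ℓ π ∧ G.lies ℓ β}) ∪
        {ℓ ∈ G.uncovered A B | G.lies ℓ π} := by
    intro ℓ hℓ
    have hℓ := (mem_filter.1 hℓ).2
    simp only [uncovered, mem_union, mem_filter, mem_univ, true_and, mem_biUnion]
    by_cases h1 : ∃ P ∈ A, G.on P ℓ
    · exact Or.inl (Or.inl ⟨hℓ, h1⟩)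
    by_cases h2 : ∃ β ∈ B, G.lies ℓ β
    · obtain ⟨β, hβ, h2⟩ := h2
      exact Or.inl (Or.inr ⟨β, hβ, hℓ, h2⟩)
    push Not at h1 h2
    exact Or.inr ⟨⟨h1, h2⟩, hℓ⟩
  have hB : ∀ β ∈ B, #{ℓ | G.lies ℓ π ∧ G.lies ℓ β} ≤ 1 := by
    intro β hβ
    refine card_le_one.2 fun a ha b hb => ?_
    have ha := (mem_filter.1 ha).2
    have hb := (mem_filter.1 hb).2
    refine G.inter_unique ?_ ha.1 ha.2 hb.1 hb.2
    rintro rfl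
    exact hπ hβ
  have h1 := (card_le_card hsub).trans (card_union_le _ _)
  have h2 := card_union_le {ℓ | G.lies ℓ π ∧ ∃ P ∈ A, G.on P ℓ}
    (B.biUnion fun β => {ℓ | G.lies ℓ π ∧ G.lies ℓ β})
  have h3 := card_biUnion_le_card_mul _ _ _ hB
  have h4 := G.card_lines_meeting_le A π
  rw [G.card_lines_in] at h1
  omega

lemma sum_card_mem_le (A : Finset Pt) (D : Finset Pl) :
    ∑ π ∈ D, #{P ∈ A | G.mem P π} ≤ #A * (q ^ 2 + q + 1) := by
  calc ∑ π ∈ D, #{P ∈ A | G.mem P π}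
      ≤ ∑ π, #{P ∈ A | G.mem P π} := sum_le_sum_of_subset (subset_univ _)
    _ = ∑ P ∈ A, #{π | G.mem P π} :=
      (sum_card_bipartiteAbove_eq_sum_card_bipartiteBelow fun P π => G.mem P π).symm
    _ = #A * (q ^ 2 + q + 1) := by simp [G.card_planes_through]

lemma sum_card_lies_le (L : Finset Ln) (D : Finset Pl) :
    ∑ π ∈ D, #{ℓ ∈ L | G.lies ℓ π} ≤ #L * (q + 1) := by
  calc ∑ π ∈ D, #{ℓ ∈ L | G.lies ℓ π}
      ≤ ∑ π, #{ℓ ∈ L | G.lies ℓ π} := sum_le_sum_of_subset (subset_univ _)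
    _ = ∑ ℓ ∈ L, #{π | G.lies ℓ π} :=
      (sum_card_bipartiteAbove_eq_sum_card_bipartiteBelow fun ℓ π => G.lies ℓ π).symm
    _ = #L * (q + 1) := by simp [G.card_planes_on]

lemma card_compl_planes (G : ProjectiveSpace q Pt Ln Pl) (B : Finset Pl) : #Bᶜ = (q + 1) * (q ^ 2 + 1) - #B := by
  rw [card_compl, G.card_planes]

/-- Some plane outside `B` has at most the average value of `c` times the number of points of `A`
in the plane plus the number of uncovered lines in the plane. -/
lemma exists_plane_le_average (A : Finset Pt) (B : Finset Pl) (c : ℕ)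
    (hB : #B < (q + 1) * (q ^ 2 + 1)) :
    ∃ π ∉ B, ((q + 1) * (q ^ 2 + 1) - #B) *
        (c * #{P ∈ A | G.mem P π} + #{ℓ ∈ G.uncovered A B | G.lies ℓ π}) ≤
      c * (#A * (q ^ 2 + q + 1)) + #(G.uncovered A B) * (q + 1) := by
  have hne : (Bᶜ).Nonempty := by
    rw [← card_pos, G.card_compl_planes]
    omega
  obtain ⟨π, hπ, hmin⟩ := exists_min_image Bᶜ
    (fun π => c * #{P ∈ A | G.mem P π} + #{ℓ ∈ G.uncovered A B | G.lies ℓ π}) hne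
  refine ⟨π, mem_compl.1 hπ, ?_⟩
  have h1 := card_nsmul_le_sum _ _ _ hmin
  rw [G.card_compl_planes, smul_eq_mul, sum_add_distrib, ← mul_sum] at h1
  refine h1.trans (add_le_add (Nat.mul_le_mul_left c (G.sum_card_mem_le A _)) ?_)
  exact G.sum_card_lies_le _ _

/-- For `s < q`, the averages for planes and for points together are too small for the lower bound
that holds for each plane outside `B` and point outside `A`. Here `a` and `b` are the cardinalities
of `A` and `B`, and `10 * q ^ 2` bounds the contribution of the uncovered lines. -/
lemma average_lt {q a b : ℝ} (hq : 47 ≤ q)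
    (hab : a + b ≤ q ^ 2 + q - 1) :
    ((q + 1) * (q ^ 2 + 1) - a) * (a * (q ^ 2 + q + 1) + 10 * q ^ 2) +
      ((q + 1) * (q ^ 2 + 1) - b) * (b * (q ^ 2 + q + 1) + 10 * q ^ 2) <
    (q + 2) * (((q + 1) * (q ^ 2 + 1) - a) * ((q + 1) * (q ^ 2 + 1) - b)) := by
  set T := q ^ 2 + q + 1 with hT
  set N := (q + 1) * (q ^ 2 + 1) with hN
  set c := 10 * q ^ 2 with hc
  obtain ⟨t, rfl⟩ : ∃ t, q = 47 + t := ⟨q - 47, by ring⟩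
  have ht : 0 ≤ t := by linarith
  set m := a + b with hm
  -- after expansion, the claim is worst when `a = b`, and then when `m = a + b` is largest,
  -- that is, equal to `T - 2`
  have h1 : (2 * T - (47 + t) - 2) * (4 * (a * b)) ≤ (2 * T - (47 + t) - 2) * m ^ 2 := by
    refine mul_le_mul_of_nonneg_left ?_ (by rw [hT]; nlinarith)
    rw [hm]
    nlinarith [sq_nonneg (a - b)]
  have h2 : 0 ≤ (T - 2 - m) *
      ((47 + t + 2 + T) * N - c - (T / 2 + (47 + t + 2) / 4) * (m + (T - 2))) := by
    refine mul_nonneg (by rw [hT]; linarith) ?_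
    have hm' : m + (T - 2) ≤ 2 * (T - 2) := by rw [hT]; linarith
    have h3 : (T / 2 + (47 + t + 2) / 4) * (m + (T - 2)) ≤
        (T / 2 + (47 + t + 2) / 4) * (2 * (T - 2)) := by
      refine mul_le_mul_of_nonneg_left hm' ?_
      rw [hT]
      positivity
    have h4 : 0 ≤ (47 + t + 2 + T) * N - c - (T / 2 + (47 + t + 2) / 4) * (2 * (T - 2)) := by
      rw [hT, hN, hc]
      ring_nf
      positivity
    linarith
  have h5 : 0 < (47 + t + 2) * N ^ 2 - 2 * c * N -
      (T - 2) * ((47 + t + 2 + T) * N - c) + (T - 2) ^ 2 * (T / 2 + (47 + t + 2) / 4) := by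
    rw [hT, hN, hc]
    ring_nf
    positivity
  have hb' : b = m - a := by rw [hm]; ring
  rw [hb'] at h1 ⊢
  nlinarith

/-- For `s ≥ q`, the average for planes alone is too small for the lower bound that holds for each
plane outside `B`. -/
lemma linear_average_lt {q a b s : ℝ} (hq : 47 ≤ q) (ha : 0 ≤ a) (hb : 0 ≤ b)
    (hs : a + b + s + 1 = q ^ 2 + q) (hsq : q ≤ s) :
    q * (a * (q ^ 2 + q + 1)) + 10 * q ^ 2 * s < ((q + 1) * (q ^ 2 + 1) - b) * (a + s + 1) := by
  have hq2 : 0 < q ^ 2 := by positivity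
  have h1 : 4 * (a * b) ≤ q ^ 4 := by
    have h : (a + b) ^ 2 ≤ (q ^ 2) ^ 2 := pow_le_pow_left₀ (by linarith) (by linarith) 2
    linarith [sq_nonneg (a - b)]
  have h2 : 0 ≤ q ^ 2 * (q - 10) := mul_nonneg hq2.le (by linarith)
  have h3 : q * (q ^ 2 * (q - 10)) ≤ (s + 1) * (q ^ 3 + q ^ 2 + q + 1 - b - 10 * q ^ 2) :=
    mul_le_mul (by linarith) (by linarith) h2 (by linarith)
  have h4 : 0 < q ^ 3 * (3 * q - 40) := mul_pos (by positivity) (by linarith)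
  linarith

/-- Fewer than `q ^ 2 + q` points and planes do not cover all lines: if there are
`q ^ 2 + q - 1 - s` of them, then more than `10 * q ^ 2 * s / (q + 1)` lines are uncovered.

A plane outside `B` that contains `x` points of `A` contains at least `q ^ 2 + q - q * x - #B`
uncovered lines, and dually. For `s ≥ q` it suffices to average this over all planes outside `B`.
For `s < q` this would be too weak. But if a plane outside `B` contains `x` points of `A` and `u`
uncovered lines, and a point outside `A` is in `y` planes of `B` and on `v` uncovered lines, then
`q * (x + y) + u + v ≥ q ^ 2 + q + s + 1`, which for integers implies
`(s + 1) * (x + y) + u + v ≥ (s + 1) * (q + 2)`, and averages of the latter suffice. -/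
theorem lt_card_uncovered (A : Finset Pt) (B : Finset Pl) {s : ℕ} (hq : 47 ≤ q)
    (hs : #A + #B + s + 1 = q ^ 2 + q) : 10 * q ^ 2 * s < #(G.uncovered A B) * (q + 1) := by
  by_contra! hU
  have hN : q ^ 2 + q < (q + 1) * (q ^ 2 + 1) := by nlinarith [Nat.zero_le (q ^ 3)]
  have hA : #A < (q + 1) * (q ^ 2 + 1) := by omega
  have hB : #B < (q + 1) * (q ^ 2 + 1) := by omega
  have hs' : (#A : ℝ) + #B + s + 1 = q ^ 2 + q := by exact_mod_cast hs
  have hq' : (47 : ℝ) ≤ q := by exact_mod_cast hq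
  have ha0 : (0 : ℝ) ≤ #A := Nat.cast_nonneg _
  have hb0 : (0 : ℝ) ≤ #B := Nat.cast_nonneg _
  have hs0 : (0 : ℝ) ≤ s := Nat.cast_nonneg _
  rcases le_or_gt (s + 1) q with hsq | hsq
  · obtain ⟨π, hπ, h1⟩ := G.exists_plane_le_average A B (s + 1) hB
    obtain ⟨P, hP, h2⟩ := G.dual.exists_plane_le_average B A (s + 1) hA
    have h3 := G.le_card_uncovered_in A B hπ
    have h4 := G.dual.le_card_uncovered_in B A hP
    rw [G.dual_uncovered] at h2 h4
    generalize #{P ∈ A | G.mem P π} = x at h1 h3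
    generalize #{π ∈ B | G.dual.mem π P} = y at h2 h4
    generalize #{ℓ ∈ G.uncovered A B | G.lies ℓ π} = u at h1 h3
    generalize #{ℓ ∈ G.uncovered A B | G.dual.lies ℓ P} = v at h2 h4
    have hkey : (s + 1) * (q + 2) ≤ ((s + 1) * x + u) + ((s + 1) * y + v) := by
      rcases le_or_gt (q + 2) (x + y) with hxy | hxy
      · nlinarith
      -- if `x + y = q + 1 - j`, then `u + v ≥ s + 1 + q * j ≥ (s + 1) * (j + 1)`
      · obtain ⟨j, hj⟩ := Nat.exists_eq_add_of_le (Nat.lt_succ_iff.1 hxy)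
        have h5 : q * (x + y) + q * j = q * (q + 1) := by rw [← mul_add]; congr 1; omega
        have h6 : (s + 1) * j ≤ q * j := Nat.mul_le_mul_right j hsq
        have h7 : (s + 1) * (x + y) + (s + 1) * j = (s + 1) * (q + 1) := by
          rw [← mul_add]; congr 1; omega
        nlinarith
    have hkey' : ((s : ℝ) + 1) * (q + 2) ≤ ((s + 1) * x + u) + ((s + 1) * y + v) := by
      exact_mod_cast hkey
    have h1' : ((q + 1 : ℝ) * (q ^ 2 + 1) - #B) * ((s + 1) * x + u) ≤
        (s + 1) * (#A * (q ^ 2 + q + 1) + 10 * q ^ 2) := by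
      have h := (Nat.cast_le (α := ℝ)).2 (h1.trans (Nat.add_le_add_left hU _))
      push_cast [Nat.cast_sub hB.le] at h
      nlinarith
    have h2' : ((q + 1 : ℝ) * (q ^ 2 + 1) - #A) * ((s + 1) * y + v) ≤
        (s + 1) * (#B * (q ^ 2 + q + 1) + 10 * q ^ 2) := by
      have h := (Nat.cast_le (α := ℝ)).2 (h2.trans (Nat.add_le_add_left hU _))
      push_cast [Nat.cast_sub hA.le] at h
      nlinarith
    have hlt := average_lt hq' (a := #A) (b := #B) (by linarith)
    have hNA : 0 < (q + 1 : ℝ) * (q ^ 2 + 1) - #A := by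
      have : (#A : ℝ) < (q + 1) * (q ^ 2 + 1) := by exact_mod_cast hA
      linarith
    have hNB : 0 < (q + 1 : ℝ) * (q ^ 2 + 1) - #B := by
      have : (#B : ℝ) < (q + 1) * (q ^ 2 + 1) := by exact_mod_cast hB
      linarith
    generalize (q + 1 : ℝ) * (q ^ 2 + 1) - #A = a' at *
    generalize (q + 1 : ℝ) * (q ^ 2 + 1) - #B = b' at *
    have k1 := mul_le_mul_of_nonneg_left h1' hNA.le
    have k2 := mul_le_mul_of_nonneg_left h2' hNB.le
    have k3 := mul_le_mul_of_nonneg_left hkey' (mul_pos hNA hNB).le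
    have k4 := mul_lt_mul_of_pos_left hlt (by linarith : (0 : ℝ) < s + 1)
    nlinarith
  · obtain ⟨π, hπ, h1⟩ := G.exists_plane_le_average A B q hB
    have h3 := G.le_card_uncovered_in A B hπ
    generalize #{P ∈ A | G.mem P π} = x at h1 h3
    generalize #{ℓ ∈ G.uncovered A B | G.lies ℓ π} = u at h1 h3
    have h := (Nat.cast_le (α := ℝ)).2 (h1.trans (Nat.add_le_add_left hU _))
    push_cast [Nat.cast_sub hB.le] at h
    have h3' : (q : ℝ) ^ 2 + q ≤ q * x + #B + u := by exact_mod_cast h3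
    have hsq' : (q : ℝ) + 1 ≤ s + 1 := by exact_mod_cast hsq
    have hNB : 0 < (q + 1 : ℝ) * (q ^ 2 + 1) - #B := by
      have : (#B : ℝ) < (q + 1) * (q ^ 2 + 1) := by exact_mod_cast hB
      linarith
    have h5 : ((q + 1 : ℝ) * (q ^ 2 + 1) - #B) * (#A + s + 1) ≤
        q * (#A * (q ^ 2 + q + 1)) + 10 * q ^ 2 * s := by
      refine le_trans (mul_le_mul_of_nonneg_left ?_ hNB.le) h
      linarith
    exact absurd h5 (not_le.2 (linear_average_lt hq' ha0 hb0 hs' (by linarith)))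

/-- For a line `m` in a plane `ε`, each line is incident with a point of `ε` not on `m` or with a
plane other than `ε` through `m`. -/
lemma exists_incident {m : Ln} {ε : Pl} (hq : 0 < q) (hm : G.lies m ε) (ℓ : Ln) :
    (∃ P, (G.mem P ε ∧ ¬ G.on P m) ∧ G.on P ℓ) ∨ ∃ π, (G.lies m π ∧ π ≠ ε) ∧ G.lies ℓ π := by
  by_cases hℓ : G.lies ℓ ε
  · by_cases hne : ℓ = m
    · have h1 : 1 < #{π | G.lies m π} := by rw [G.card_planes_on]; omega
      obtain ⟨π, hπ, hne'⟩ := exists_mem_ne h1 ε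
      have hπ := (mem_filter.1 hπ).2
      exact Or.inr ⟨π, ⟨hπ, hne'⟩, hne ▸ hπ⟩
    · have h1 : 1 < #{P | G.on P ℓ} := by rw [G.card_points_on]; omega
      obtain ⟨P, hP, P', hP', hPP⟩ := one_lt_card.1 h1
      have hP := (mem_filter.1 hP).2
      have hP' := (mem_filter.1 hP').2
      by_cases h2 : G.on P m
      · refine Or.inl ⟨P', ⟨G.mem_of_on hP' hℓ, fun h3 => hne ?_⟩, hP'⟩
        exact G.join_unique hPP hP hP' h2 h3
      · exact Or.inl ⟨P, ⟨G.mem_of_on hP hℓ, h2⟩, hP⟩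
  · obtain ⟨P, hPε, hP⟩ := G.exists_point ε ℓ
    by_cases h2 : G.on P m
    · obtain ⟨π, hπ, hπ'⟩ := G.meet_iff.1 ⟨P, hP, h2⟩
      refine Or.inr ⟨π, ⟨hπ', ?_⟩, hπ⟩
      rintro rfl
      exact hℓ hπ
    · exact Or.inl ⟨P, ⟨hPε, h2⟩, hP⟩

lemma card_points_off_line {m : Ln} {ε : Pl} (hm : G.lies m ε) :
    #{P | G.mem P ε ∧ ¬ G.on P m} = q ^ 2 := by
  have h1 : ({P | G.mem P ε ∧ ¬ G.on P m} : Finset Pt) =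
      ({P | G.mem P ε} : Finset Pt) \ ({P | G.on P m} : Finset Pt) := by
    ext P
    simp
  have h2 : ({P | G.on P m} : Finset Pt) ⊆ ({P | G.mem P ε} : Finset Pt) := by
    intro P hP
    have hP := (mem_filter.1 hP).2
    simpa using G.mem_of_on hP hm
  rw [h1, card_sdiff_of_subset h2, G.card_points_in, G.card_points_on]
  omega

lemma card_other_planes {m : Ln} {ε : Pl} (hm : G.lies m ε) :
    #{π | G.lies m π ∧ π ≠ ε} = q := by
  have h1 : ({π | G.lies m π ∧ π ≠ ε} : Finset Pl) = ({π | G.lies m π} : Finset Pl).erase ε := by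
    ext π
    simp [and_comm]
  rw [h1, card_erase_of_mem (by simpa using hm), G.card_planes_on]
  rfl

end ProjectiveSpace

end Abstract

end PG3

/-! ### Subspaces of a 4-dimensional vector space -/

namespace PG3

section Counting

open Module Finset

variable {K V : Type*} [Field K] [Finite K] [AddCommGroup V] [Module K V] [Module.Finite K V]

lemma card_sdiff_submodule {W X : Submodule K V} (h : W ≤ X) :
    Nat.card {v // v ∈ X ∧ v ∉ W} = Nat.card K ^ finrank K X - Nat.card K ^ finrank K W := by
  have : Finite V := Module.finite_of_finite K
  rw [← Module.natCard_eq_pow_finrank (K := K) (V := X),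
    ← Module.natCard_eq_pow_finrank (K := K) (V := W)]
  exact Set.ncard_sdiff (s := (W : Set V)) (t := X) h

/-- The number of subspaces between `W` and `W'` whose dimension exceeds that of `W` by one. Each
vector of `W'` outside `W` is in exactly one of them. -/
lemma card_covering {W W' : Submodule K V} (h : W ≤ W') {d : ℕ}
    (hd : finrank K W' = finrank K W + d) :
    Nat.card {X : Submodule K V // W ≤ X ∧ X ≤ W' ∧ finrank K X = finrank K W + 1} =
      ∑ i ∈ range d, Nat.card K ^ i := by
  have hV : Finite V := Module.finite_of_finite K
  have hq : 1 < Nat.card K := Finite.one_lt_card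
  let 𝒳 := {X : Submodule K V // W ≤ X ∧ X ≤ W' ∧ finrank K X = finrank K W + 1}
  have _ := Fintype.ofFinite 𝒳
  have hsup : ∀ X : 𝒳, ∀ v, v ∈ X.1 → v ∉ W → W ⊔ Submodule.span K {v} = X.1 := by
    intro X v hv hvW
    refine Submodule.eq_of_le_of_finrank_eq
      (sup_le X.2.1 ((Submodule.span_singleton_le_iff_mem _ _).2 hv)) ?_
    rw [Submodule.finrank_sup_span_singleton hvW, X.2.2.2]
  let e : {v // v ∈ W' ∧ v ∉ W} ≃ Σ X : 𝒳, {v // v ∈ X.1 ∧ v ∉ W} :=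
    { toFun v := ⟨⟨W ⊔ Submodule.span K {v.1}, le_sup_left,
          sup_le h ((Submodule.span_singleton_le_iff_mem _ _).2 v.2.1),
          Submodule.finrank_sup_span_singleton v.2.2⟩,
        v.1, le_sup_right (a := W) (Submodule.mem_span_singleton_self _), v.2.2⟩
      invFun v := ⟨v.2.1, v.1.2.2.1 v.2.2.1, v.2.2.2⟩
      left_inv _ := rfl
      right_inv := by
        rintro ⟨X, v, hv, hvW⟩
        have hX : (⟨W ⊔ Submodule.span K {v}, le_sup_left,
            sup_le h ((Submodule.span_singleton_le_iff_mem _ _).2 (X.2.2.1 hv)),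
            Submodule.finrank_sup_span_singleton hvW⟩ : 𝒳) = X := Subtype.ext (hsup X v hv hvW)
        refine Sigma.subtype_ext hX rfl }
  have hcard := Nat.card_congr e
  rw [Nat.card_sigma, card_sdiff_submodule h] at hcard
  simp_rw [fun X : 𝒳 => card_sdiff_submodule X.2.1, fun X : 𝒳 => X.2.2.2] at hcard
  rw [sum_const, card_univ, ← Nat.card_eq_fintype_card, smul_eq_mul, hd] at hcard
  have hpos : 0 < Nat.card K ^ (finrank K W + 1) - Nat.card K ^ finrank K W :=
    Nat.sub_pos_of_lt (Nat.pow_lt_pow_right hq (Nat.lt_succ_self _))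
  refine Nat.eq_of_mul_eq_mul_right hpos ?_
  rw [← hcard, pow_succ, pow_add, ← Nat.mul_sub_one, ← Nat.mul_sub_one,
    ← geom_sum_mul_of_one_le hq.le d]
  ring

/-- The number of subspaces between `W` and `W'` that are hyperplanes of `W'`. -/
lemma card_covered {W W' : Submodule K V} (h : W ≤ W') {d : ℕ}
    (hd : finrank K W' = finrank K W + d) :
    Nat.card {X : Submodule K V // W ≤ X ∧ X ≤ W' ∧ finrank K X + 1 = finrank K W'} =
      ∑ i ∈ range d, Nat.card K ^ i := by
  have hfin : ∀ X : Submodule K V, finrank K X + finrank K X.dualAnnihilator = finrank K V :=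
    fun X => Subspace.finrank_add_finrank_dualAnnihilator_eq X
  have h1 := hfin W
  have h2 := hfin W'
  rw [← card_covering (W := W'.dualAnnihilator) (W' := W.dualAnnihilator)
    (Submodule.dualAnnihilator_anti h) (d := d) (by omega)]
  refine Nat.card_congr (Equiv.subtypeEquiv
    ((Subspace.orderIsoFiniteDimensional (K := K) (V := V)).toEquiv.trans OrderDual.ofDual) ?_)
  intro X
  have h3 := hfin X
  change _ ↔ W'.dualAnnihilator ≤ X.dualAnnihilator ∧ X.dualAnnihilator ≤ W.dualAnnihilator ∧
    finrank K X.dualAnnihilator = finrank K W'.dualAnnihilator + 1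
  rw [Subspace.dualAnnihilator_le_dualAnnihilator_iff,
    Subspace.dualAnnihilator_le_dualAnnihilator_iff, and_left_comm]
  have h4 : finrank K X + 1 = finrank K W' ↔
      finrank K X.dualAnnihilator = finrank K W'.dualAnnihilator + 1 := by omega
  rw [h4]

lemma card_filter_subtype {α : Type*} (p r : α → Prop) [Fintype {x // p x}]
    [DecidablePred fun x : {x // p x} => r x] :
    #{x : {x // p x} | r x} = Nat.card {x // p x ∧ r x} := by
  rw [← Fintype.card_subtype, ← Nat.card_eq_fintype_card]
  exact Nat.card_congr (Equiv.subtypeSubtypeEquivSubtypeInter p r)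

lemma card_filter_covering {W W' : Submodule K V} (h : W ≤ W') {d : ℕ}
    (hd : finrank K W' = finrank K W + d) {p r : Submodule K V → Prop} [Fintype {x // p x}]
    [DecidablePred fun x : {x // p x} => r x]
    (hpr : ∀ X, p X ∧ r X ↔ W ≤ X ∧ X ≤ W' ∧ finrank K X = finrank K W + 1) :
    #{x : {x // p x} | r x} = ∑ i ∈ range d, Nat.card K ^ i := by
  rw [card_filter_subtype, ← card_covering h hd]
  exact Nat.card_congr (Equiv.subtypeEquivRight hpr)

lemma card_filter_covered {W W' : Submodule K V} (h : W ≤ W') {d : ℕ}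
    (hd : finrank K W' = finrank K W + d) {p r : Submodule K V → Prop} [Fintype {x // p x}]
    [DecidablePred fun x : {x // p x} => r x]
    (hpr : ∀ X, p X ∧ r X ↔ W ≤ X ∧ X ≤ W' ∧ finrank K X + 1 = finrank K W') :
    #{x : {x // p x} | r x} = ∑ i ∈ range d, Nat.card K ^ i := by
  rw [card_filter_subtype, ← card_covered h hd]
  exact Nat.card_congr (Equiv.subtypeEquivRight hpr)

end Counting

section VectorSpace

open Module Finset

variable {K V : Type*} [Field K] [AddCommGroup V] [Module K V] [Module.Finite K V]

lemma finrank_sup_of_points {P P' : Submodule K V} (hP : IsPoint P) (hP' : IsPoint P')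
    (hne : P ≠ P') : finrank K (P ⊔ P' : Submodule K V) = 2 := by
  unfold IsPoint at hP hP'
  have h := Submodule.finrank_sup_add_finrank_inf_eq P P'
  have hlt : P ⊓ P' < P := lt_of_le_of_ne inf_le_left fun h =>
    hne (Submodule.eq_of_le_of_finrank_eq (inf_eq_left.1 h) (by omega))
  have := Submodule.finrank_lt_finrank_of_lt hlt
  omega

lemma finrank_inf_of_planes (hV : finrank K V = 4) {π π' : Submodule K V} (hπ : IsPlane π)
    (hπ' : IsPlane π') (hne : π ≠ π') : finrank K (π ⊓ π' : Submodule K V) = 2 := by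
  unfold IsPlane at hπ hπ'
  have h := Submodule.finrank_sup_add_finrank_inf_eq π π'
  have hlt : π < π ⊔ π' := lt_of_le_of_ne le_sup_left fun h =>
    hne (Submodule.eq_of_le_of_finrank_eq (left_eq_sup.1 h) (by omega)).symm
  have h1 := Submodule.finrank_lt_finrank_of_lt hlt
  have h2 := (π ⊔ π').finrank_le
  omega

lemma sup_eq_line {P P' ℓ : Submodule K V} (hP : IsPoint P) (hP' : IsPoint P') (hne : P ≠ P')
    (hℓ : IsLine ℓ) (h : P ≤ ℓ) (h' : P' ≤ ℓ) : P ⊔ P' = ℓ :=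
  Submodule.eq_of_le_of_finrank_eq (sup_le h h')
    ((finrank_sup_of_points hP hP' hne).trans hℓ.symm)

lemma inf_eq_line (hV : finrank K V = 4) {π π' ℓ : Submodule K V} (hπ : IsPlane π)
    (hπ' : IsPlane π') (hne : π ≠ π') (hℓ : IsLine ℓ) (h : ℓ ≤ π) (h' : ℓ ≤ π') : ℓ = π ⊓ π' :=
  Submodule.eq_of_le_of_finrank_eq (le_inf h h')
    (hℓ.trans (finrank_inf_of_planes hV hπ hπ' hne).symm)

omit [Module.Finite K V] in
lemma exists_isPoint_le {X : Submodule K V} (hX : X ≠ ⊥) :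
    ∃ P : Submodule K V, IsPoint P ∧ P ≤ X := by
  obtain ⟨v, hv, hv0⟩ := Submodule.exists_mem_ne_zero_of_ne_bot hX
  exact ⟨Submodule.span K {v}, finrank_span_singleton hv0,
    (Submodule.span_singleton_le_iff_mem _ _).2 hv⟩

lemma exists_isPlane_ge (hV : finrank K V = 4) {ℓ : Submodule K V} (hℓ : IsLine ℓ) :
    ∃ π : Submodule K V, IsPlane π ∧ ℓ ≤ π := by
  unfold IsLine at hℓ
  have : ℓ < ⊤ := lt_top_iff_ne_top.2 fun h => by
    rw [h, finrank_top] at hℓ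
    omega
  obtain ⟨v, -, hv⟩ := SetLike.exists_of_lt this
  exact ⟨ℓ ⊔ Submodule.span K {v}, by
    rw [IsPlane, Submodule.finrank_sup_span_singleton hv, hℓ], le_sup_left⟩

omit [Module.Finite K V] in
lemma line_ne_bot {ℓ : Submodule K V} (hℓ : IsLine ℓ) : ℓ ≠ ⊥ := by
  rintro rfl
  simp [IsLine] at hℓ

/-- Two lines are skew if and only if they are not coplanar. -/
lemma not_disjoint_iff_coplanar (hV : finrank K V = 4) {ℓ ℓ' : Submodule K V} (hℓ : IsLine ℓ)
    (hℓ' : IsLine ℓ') : ¬ Disjoint ℓ ℓ' ↔ ∃ π : Submodule K V, IsPlane π ∧ ℓ ≤ π ∧ ℓ' ≤ π := by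
  by_cases hne : ℓ = ℓ'
  · subst hne
    simp only [disjoint_self, line_ne_bot hℓ, not_false_eq_true, and_self, true_iff]
    exact exists_isPlane_ge hV hℓ
  have hadd := Submodule.finrank_sup_add_finrank_inf_eq ℓ ℓ'
  have h4 := (ℓ ⊔ ℓ').finrank_le
  unfold IsLine at hℓ hℓ'
  constructor
  · intro h
    refine ⟨ℓ ⊔ ℓ', ?_, le_sup_left, le_sup_right⟩
    have h0 : finrank K (ℓ ⊓ ℓ' : Submodule K V) ≠ 0 := fun h0 =>
      h (disjoint_iff.2 (Submodule.finrank_eq_zero.1 h0))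
    have hlt : ℓ ⊓ ℓ' < ℓ := lt_of_le_of_ne inf_le_left fun h =>
      hne (Submodule.eq_of_le_of_finrank_eq (inf_eq_left.1 h) (by omega))
    have := Submodule.finrank_lt_finrank_of_lt hlt
    unfold IsPlane
    omega
  · rintro ⟨π, hπ, h, h'⟩ hd
    have h1 := Submodule.finrank_mono (sup_le h h')
    rw [hd.eq_bot, finrank_bot] at hadd
    unfold IsPlane at hπ
    omega

omit [Module.Finite K V] in
lemma not_disjoint_iff_concurrent {ℓ ℓ' : Submodule K V} :
    ¬ Disjoint ℓ ℓ' ↔ ∃ P : Submodule K V, IsPoint P ∧ P ≤ ℓ ∧ P ≤ ℓ' := by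
  constructor
  · intro h
    obtain ⟨P, hP, hle⟩ := exists_isPoint_le fun hb => h (disjoint_iff.2 hb)
    exact ⟨P, hP, le_inf_iff.1 hle⟩
  · rintro ⟨P, hP, h, h'⟩ hd
    have : P = ⊥ := le_bot_iff.1 (hd h h')
    rw [this, IsPoint, finrank_bot] at hP
    omega

lemma exists_plane_of_point_line (hV : finrank K V = 4) {P ℓ : Submodule K V} (hP : IsPoint P)
    (hℓ : IsLine ℓ) : ∃ π : Submodule K V, IsPlane π ∧ P ≤ π ∧ ℓ ≤ π := by
  by_cases h : P ≤ ℓ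
  · obtain ⟨π, hπ, hle⟩ := exists_isPlane_ge hV hℓ
    exact ⟨π, hπ, h.trans hle, hle⟩
  refine ⟨P ⊔ ℓ, ?_, le_sup_left, le_sup_right⟩
  have hadd := Submodule.finrank_sup_add_finrank_inf_eq P ℓ
  have hlt : P ⊓ ℓ < P := lt_of_le_of_ne inf_le_left fun he => h (inf_eq_left.1 he)
  have := Submodule.finrank_lt_finrank_of_lt hlt
  unfold IsPoint at hP
  unfold IsLine at hℓ
  unfold IsPlane
  omega

lemma exists_point_of_plane_line (hV : finrank K V = 4) {π ℓ : Submodule K V} (hπ : IsPlane π)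
    (hℓ : IsLine ℓ) : ∃ P : Submodule K V, IsPoint P ∧ P ≤ π ∧ P ≤ ℓ := by
  rw [← not_disjoint_iff_concurrent]
  intro hd
  have hadd := Submodule.finrank_sup_add_finrank_inf_eq π ℓ
  have h4 := (π ⊔ ℓ).finrank_le
  rw [hd.eq_bot, finrank_bot] at hadd
  unfold IsLine at hℓ
  unfold IsPlane at hπ
  omega

variable (K V) in
/-- The points of `PG(3,q)`. -/
abbrev Point := {x : Submodule K V // IsPoint x}

variable (K V) in
/-- The lines of `PG(3,q)`. -/
abbrev Line := {x : Submodule K V // IsLine x}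

variable (K V) in
/-- The planes of `PG(3,q)`. -/
abbrev Plane := {x : Submodule K V // IsPlane x}

open scoped Classical in
/-- The subspaces of a 4-dimensional vector space as a `ProjectiveSpace`. -/
def space [Finite K] (hV : finrank K V = 4) {q : ℕ} (hq : Nat.card K = q) [Fintype (Point K V)]
    [Fintype (Line K V)] [Fintype (Plane K V)] :
    ProjectiveSpace q (Point K V) (Line K V) (Plane K V) where
  on P ℓ := P.1 ≤ ℓ.1
  lies ℓ π := ℓ.1 ≤ π.1
  mem P π := P.1 ≤ π.1
  mem_of_on h h' := h.trans h'
  card_points := by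
    classical
    have h := card_filter_covering (K := K) (V := V) (W := ⊥) (W' := ⊤) bot_le (d := 4)
      (by simp [hV]) (p := IsPoint) (r := fun _ => True) (by simp [IsPoint])
    simp only [filter_true, card_univ] at h
    rw [h, hq]
    simp only [sum_range_succ, range_zero, sum_empty]
    ring
  card_planes := by
    classical
    have h := card_filter_covered (K := K) (V := V) (W := ⊥) (W' := ⊤) bot_le (d := 4)
      (by simp [hV]) (p := IsPlane) (r := fun _ => True) (by simp [IsPlane, hV])
    simp only [filter_true, card_univ] at h
    rw [h, hq]
    simp only [sum_range_succ, range_zero, sum_empty]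
    ring
  card_lines_on P := by
    have hP : finrank K P.1 = 1 := P.2
    rw [card_filter_covering (W := P.1) (W' := ⊤) le_top (d := 3) (by rw [hP, finrank_top, hV])
      (p := IsLine) (r := fun X => P.1 ≤ X) (by simp [IsLine, hP, and_comm]), hq]
    simp only [sum_range_succ, range_zero, sum_empty]
    ring
  card_lines_in π := by
    have hπ : finrank K π.1 = 3 := π.2
    rw [card_filter_covered (W := ⊥) (W' := π.1) bot_le (d := 3) (by rw [hπ, finrank_bot])
      (p := IsLine) (r := fun X => X ≤ π.1) (by simp [IsLine, hπ, and_comm]), hq]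
    simp only [sum_range_succ, range_zero, sum_empty]
    ring
  card_points_on ℓ := by
    have hℓ : finrank K ℓ.1 = 2 := ℓ.2
    rw [card_filter_covering (W := ⊥) (W' := ℓ.1) bot_le (d := 2) (by rw [hℓ, finrank_bot])
      (p := IsPoint) (r := fun X => X ≤ ℓ.1) (by simp [IsPoint, and_comm]), hq]
    simp only [sum_range_succ, range_zero, sum_empty]
    ring
  card_planes_on ℓ := by
    have hℓ : finrank K ℓ.1 = 2 := ℓ.2
    rw [card_filter_covering (W := ℓ.1) (W' := ⊤) le_top (d := 2) (by rw [hℓ, finrank_top, hV])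
      (p := IsPlane) (r := fun X => ℓ.1 ≤ X) (by simp [IsPlane, hℓ, and_comm]), hq]
    simp only [sum_range_succ, range_zero, sum_empty]
    ring
  card_points_in π := by
    have hπ : finrank K π.1 = 3 := π.2
    rw [card_filter_covering (W := ⊥) (W' := π.1) bot_le (d := 3) (by rw [hπ, finrank_bot])
      (p := IsPoint) (r := fun X => X ≤ π.1) (by simp [IsPoint, and_comm]), hq]
    simp only [sum_range_succ, range_zero, sum_empty]
    ring
  card_planes_through P := by
    have hP : finrank K P.1 = 1 := P.2
    rw [card_filter_covered (W := P.1) (W' := ⊤) le_top (d := 3) (by rw [hP, finrank_top, hV])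
      (p := IsPlane) (r := fun X => P.1 ≤ X) (by simp [IsPlane, hV, and_comm]), hq]
    simp only [sum_range_succ, range_zero, sum_empty]
    ring
  card_pencil {P π} h := by
    have hP : finrank K P.1 = 1 := P.2
    have hπ : finrank K π.1 = 3 := π.2
    rw [card_filter_covering (W := P.1) (W' := π.1) h (d := 2) (by rw [hP, hπ])
      (p := IsLine) (r := fun X => P.1 ≤ X ∧ X ≤ π.1)
      (fun X => by simp only [IsLine, hP]; tauto), hq]
    simp only [sum_range_succ, range_zero, sum_empty]
    ring
  card_planes_pair {P P'} hne := by
    have h2 := finrank_sup_of_points P.2 P'.2 (Subtype.coe_ne_coe.2 hne)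
    rw [card_filter_covering (W := P.1 ⊔ P'.1) (W' := ⊤) le_top (d := 2)
      (by rw [h2, finrank_top, hV]) (p := IsPlane) (r := fun X => P.1 ≤ X ∧ P'.1 ≤ X)
      (fun X => by simp only [IsPlane, h2, sup_le_iff, le_top, true_and]; tauto), hq]
    simp only [sum_range_succ, range_zero, sum_empty]
    ring
  card_points_pair {π π'} hne := by
    have h2 := finrank_inf_of_planes hV π.2 π'.2 (Subtype.coe_ne_coe.2 hne)
    rw [card_filter_covering (W := ⊥) (W' := π.1 ⊓ π'.1) bot_le (d := 2)
      (by rw [h2, finrank_bot]) (p := IsPoint) (r := fun X => X ≤ π.1 ∧ X ≤ π'.1)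
      (fun X => by simp only [IsPoint, finrank_bot, le_inf_iff, bot_le, true_and]; tauto), hq]
    simp only [sum_range_succ, range_zero, sum_empty]
    ring
  exists_join {P P'} hne :=
    ⟨⟨P.1 ⊔ P'.1, finrank_sup_of_points P.2 P'.2 (Subtype.coe_ne_coe.2 hne)⟩,
      le_sup_left, le_sup_right⟩
  exists_inter {π π'} hne :=
    ⟨⟨π.1 ⊓ π'.1, finrank_inf_of_planes hV π.2 π'.2 (Subtype.coe_ne_coe.2 hne)⟩,
      inf_le_left, inf_le_right⟩
  lies_of_two {P P' ℓ π} hne h h' hπ hπ' := by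
    rw [← sup_eq_line P.2 P'.2 (Subtype.coe_ne_coe.2 hne) ℓ.2 h h']
    exact sup_le hπ hπ'
  on_of_two {P ℓ π π'} hne h h' hP hP' := by
    rw [inf_eq_line hV π.2 π'.2 (Subtype.coe_ne_coe.2 hne) ℓ.2 h h']
    exact le_inf hP hP'
  join_unique {P P' ℓ ℓ'} hne h1 h2 h3 h4 := Subtype.ext
    ((sup_eq_line P.2 P'.2 (Subtype.coe_ne_coe.2 hne) ℓ.2 h1 h2).symm.trans
      (sup_eq_line P.2 P'.2 (Subtype.coe_ne_coe.2 hne) ℓ'.2 h3 h4))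
  inter_unique {π π' ℓ ℓ'} hne h1 h2 h3 h4 := Subtype.ext
    ((inf_eq_line hV π.2 π'.2 (Subtype.coe_ne_coe.2 hne) ℓ.2 h1 h2).trans
      (inf_eq_line hV π.2 π'.2 (Subtype.coe_ne_coe.2 hne) ℓ'.2 h3 h4).symm)
  meet_iff {ℓ ℓ'} := by
    have h := (not_disjoint_iff_concurrent (ℓ := ℓ.1) (ℓ' := ℓ'.1)).symm.trans
      (not_disjoint_iff_coplanar hV ℓ.2 ℓ'.2)
    constructor
    · rintro ⟨P, hP⟩
      obtain ⟨π, hπ, h⟩ := h.1 ⟨P.1, P.2, hP⟩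
      exact ⟨⟨π, hπ⟩, h⟩
    · rintro ⟨π, hπ⟩
      obtain ⟨P, hP, h⟩ := h.2 ⟨π.1, π.2, hπ⟩
      exact ⟨⟨P, hP⟩, h⟩
  exists_plane P ℓ := by
    obtain ⟨π, hπ, h⟩ := exists_plane_of_point_line hV P.2 ℓ.2
    exact ⟨⟨π, hπ⟩, h⟩
  exists_point π ℓ := by
    obtain ⟨P, hP, h⟩ := exists_point_of_plane_line hV π.2 ℓ.2
    exact ⟨⟨P, hP⟩, h⟩

end VectorSpace

end PG3

/-! ### Chambers and their colourings -/

namespace PG3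

section Chambers

open Module Finset
open scoped Classical

variable {K V : Type*} [Field K] [AddCommGroup V] [Module K V]

/-- The point of a chamber, as an element of the type of points. -/
def Chamber.pt (c : Chamber K V) : Point K V := ⟨c.point, c.isPoint⟩

/-- The line of a chamber, as an element of the type of lines. -/
def Chamber.ln (c : Chamber K V) : Line K V := ⟨c.line, c.isLine⟩

/-- The plane of a chamber, as an element of the type of planes. -/
def Chamber.pl (c : Chamber K V) : Plane K V := ⟨c.plane, c.isPlane⟩

lemma incident_point {x : Submodule K V} (hx : IsPoint x) [Module.Finite K V] {ℓ : Submodule K V}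
    (hℓ : IsLine ℓ) : Incident x ℓ ↔ x ≤ ℓ := by
  refine or_iff_left fun h => ?_
  have := Submodule.finrank_mono h
  unfold IsPoint at hx
  unfold IsLine at hℓ
  omega

lemma incident_plane {x : Submodule K V} (hx : IsPlane x) [Module.Finite K V] {ℓ : Submodule K V}
    (hℓ : IsLine ℓ) : Incident x ℓ ↔ ℓ ≤ x := by
  refine or_iff_right fun h => ?_
  have := Submodule.finrank_mono h
  unfold IsPlane at hx
  unfold IsLine at hℓ
  omega

variable [Finite K] [Module.Finite K V]

omit [Finite K] in
/-- The chambers `F x` are pairwise non-opposite: any two of their lines meet. -/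
lemma isIndepSet_F (hV : finrank K V = 4) {x : Submodule K V} (hx : IsPoint x ∨ IsPlane x) :
    (chamberGraph K V).IsIndepSet (F x) := by
  intro c hc d hd _ hop
  have hdisj : Disjoint c.line d.line := hop.2.1
  rcases hx with hx | hx
  · exact not_disjoint_iff_concurrent.2
      ⟨x, hx, (incident_point hx c.isLine).1 hc, (incident_point hx d.isLine).1 hd⟩ hdisj
  · exact (not_disjoint_iff_coplanar hV c.isLine d.isLine).2
      ⟨x, hx, (incident_plane hx c.isLine).1 hc, (incident_plane hx d.isLine).1 hd⟩ hdisj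

section Counting

variable [Fintype (Point K V)] [Fintype (Line K V)] [Fintype (Plane K V)] [Fintype (Chamber K V)]

lemma card_chambers_on_line (hV : finrank K V = 4) {q : ℕ} (hq : Nat.card K = q) (ℓ : Line K V) :
    #{c : Chamber K V | c.ln = ℓ} = (q + 1) ^ 2 := by
  have hprod := card_product {P | (space hV hq).on P ℓ} {π | (space hV hq).lies ℓ π}
  rw [(space hV hq).card_points_on, (space hV hq).card_planes_on] at hprod
  rw [sq, ← hprod]
  refine card_bij (fun c _ => (c.pt, c.pl)) ?_ ?_ ?_
  · intro c hc
    obtain rfl := (mem_filter.1 hc).2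
    exact mem_product.2 ⟨mem_filter.2 ⟨mem_univ _, c.point_le_line⟩,
      mem_filter.2 ⟨mem_univ _, c.line_le_plane⟩⟩
  · intro c hc d hd h
    have hl : c.ln = d.ln := (mem_filter.1 hc).2.trans (mem_filter.1 hd).2.symm
    simp only [Prod.mk.injEq] at h
    exact Chamber.ext (congrArg Subtype.val h.1) (congrArg Subtype.val hl)
      (congrArg Subtype.val h.2)
  · rintro ⟨P, π⟩ h
    obtain ⟨hP, hπ⟩ := mem_product.1 h
    exact ⟨⟨P.1, ℓ.1, π.1, P.2, ℓ.2, π.2, (mem_filter.1 hP).2, (mem_filter.1 hπ).2⟩,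
      mem_filter.2 ⟨mem_univ _, rfl⟩, rfl⟩

lemma card_chambers_on_lines (hV : finrank K V = 4) {q : ℕ} (hq : Nat.card K = q)
    (L : Finset (Line K V)) : #{c : Chamber K V | c.ln ∈ L} = #L * (q + 1) ^ 2 := by
  rw [card_eq_sum_card_fiberwise (f := Chamber.ln) (t := L) fun c hc => by simpa using hc]
  rw [← smul_eq_mul, ← sum_const]
  refine sum_congr rfl fun ℓ hℓ => ?_
  rw [← card_chambers_on_line hV hq ℓ, filter_filter]
  congr 1
  refine filter_congr fun c _ => ⟨fun h => h.2, ?_⟩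
  rintro rfl
  exact ⟨hℓ, rfl⟩

end Counting

lemma ncard_F (hV : finrank K V = 4) {q : ℕ} (hq : Nat.card K = q) {x : Submodule K V}
    (hx : IsPoint x ∨ IsPlane x) : (F x).ncard = (q ^ 2 + q + 1) * (q + 1) ^ 2 := by
  have : Finite V := Module.finite_of_finite K
  have _ := Fintype.ofFinite (Point K V)
  have _ := Fintype.ofFinite (Line K V)
  have _ := Fintype.ofFinite (Plane K V)
  have _ := Fintype.ofFinite (Chamber K V)
  have hF : F x = (({c : Chamber K V | c.ln ∈ ({ℓ | Incident x ℓ.1} : Finset (Line K V))} :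
      Finset (Chamber K V)) : Set (Chamber K V)) := by
    ext c
    simp [F, Chamber.ln]
  rw [hF, Set.ncard_coe_finset, card_chambers_on_lines hV hq]
  congr 1
  rcases hx with hx | hx
  · rw [← (space hV hq).card_lines_on ⟨x, hx⟩]
    exact congrArg card (filter_congr fun ℓ _ => incident_point hx ℓ.2)
  · rw [← (space hV hq).card_lines_in ⟨x, hx⟩]
    exact congrArg card (filter_congr fun ℓ _ => incident_plane hx ℓ.2)

lemma meet_space_iff [Fintype (Point K V)] [Fintype (Line K V)] [Fintype (Plane K V)]
    (hV : finrank K V = 4) {q : ℕ} (hq : Nat.card K = q) {ℓ ℓ' : Line K V} :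
    (space hV hq).Meet ℓ ℓ' ↔ ¬ Disjoint ℓ.1 ℓ'.1 := by
  rw [not_disjoint_iff_concurrent]
  exact ⟨fun ⟨P, hP⟩ => ⟨P.1, P.2, hP⟩, fun ⟨P, hP, h⟩ => ⟨⟨P, hP⟩, h⟩⟩

/-- Maximal independent sets other than the sets `F x` are small. -/
theorem ncard_le_of_maximal (hV : finrank K V = 4) {q : ℕ} (hKq : Nat.card K = q) (hq : 43 ≤ q)
    {S : Set (Chamber K V)} (hS : Maximal (chamberGraph K V).IsIndepSet S)
    (hF : ¬ ∃ x : Submodule K V, (IsPoint x ∨ IsPlane x) ∧ S = F x) :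
    S.ncard ≤ 10 * q ^ 2 * (q + 1) := by
  have : Finite V := Module.finite_of_finite K
  have _ := Fintype.ofFinite (Point K V)
  have _ := Fintype.ofFinite (Line K V)
  have _ := Fintype.ofFinite (Plane K V)
  have _ := Fintype.ofFinite (Chamber K V)
  have hout : ∀ x : Submodule K V, IsPoint x ∨ IsPlane x → ∃ c ∈ S, ¬ Incident x c.line := by
    intro x hx
    by_contra! hcon
    exact hF ⟨x, hx, hS.eq_of_le (isIndepSet_F hV hx) hcon⟩
  rw [Set.ncard_eq_toFinset_card' S]
  refine (space hV hKq).card_le_of_independent (p := Chamber.pt) (l := Chamber.ln)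
    (h := Chamber.pl) (fun c => c.point_le_line) (fun c => c.line_le_plane) ?_ ?_ ?_ ?_ hq
  · intro c _ d _ h1 h2 h3
    exact Chamber.ext (congrArg Subtype.val h1) (congrArg Subtype.val h2)
      (congrArg Subtype.val h3)
  · intro c hc d hd
    rw [meet_space_iff]
    by_contra! hcon
    have hne : c ≠ d := by
      rintro rfl
      exact hcon.1 (c.point_le_line.trans c.line_le_plane)
    exact hS.prop (Set.mem_toFinset.1 hc) (Set.mem_toFinset.1 hd) hne
      ⟨hcon.1, hcon.2.2, hcon.2.1⟩
  · intro P
    obtain ⟨c, hc, hn⟩ := hout P.1 (Or.inl P.2)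
    exact ⟨c, Set.mem_toFinset.2 hc, fun h => hn (Or.inl h)⟩
  · intro π
    obtain ⟨c, hc, hn⟩ := hout π.1 (Or.inr π.2)
    exact ⟨c, Set.mem_toFinset.2 hc, fun h => hn (Or.inr h)⟩

/-- For a line `m` in a plane `ε`, the sets `F x`, where `x` is a point of `ε` not on `m` or a plane
other than `ε` through `m`, cover all chambers. -/
lemma colorable (hV : finrank K V = 4) {q : ℕ} (hKq : Nat.card K = q) :
    (chamberGraph K V).Colorable (q ^ 2 + q) := by
  have : Finite V := Module.finite_of_finite K
  have _ := Fintype.ofFinite (Point K V)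
  have _ := Fintype.ofFinite (Line K V)
  have _ := Fintype.ofFinite (Plane K V)
  have hq0 : 0 < q := hKq ▸ Nat.card_pos
  set G := space hV hKq
  obtain ⟨ε⟩ : Nonempty (Plane K V) := G.dual.nonempty_points
  obtain ⟨m, hm⟩ : ∃ m, G.lies m ε := by
    have h : 0 < #{ℓ | G.lies ℓ ε} := by rw [G.card_lines_in]; positivity
    obtain ⟨m, hm⟩ := card_pos.1 h
    exact ⟨m, (mem_filter.1 hm).2⟩
  let A := {P // G.mem P ε ∧ ¬ G.on P m}
  let B := {π // G.lies m π ∧ π ≠ ε}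
  have hcol : ∀ ℓ : Line K V, ∃ x : A ⊕ B,
      Sum.elim (fun P => G.on P.1 ℓ) (fun π => G.lies ℓ π.1) x := by
    intro ℓ
    rcases G.exists_incident hq0 hm ℓ with ⟨P, hP, h⟩ | ⟨π, hπ, h⟩
    · exact ⟨Sum.inl ⟨P, hP⟩, h⟩
    · exact ⟨Sum.inr ⟨π, hπ⟩, h⟩
  choose col hcol using hcol
  let C : (chamberGraph K V).Coloring (A ⊕ B) := SimpleGraph.Coloring.mk (fun c => col c.ln) <| by
    intro c d hop heq
    have hdisj : Disjoint c.line d.line := hop.2.1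
    have hc := hcol c.ln
    have hd := hcol d.ln
    rw [← heq] at hd
    refine (meet_space_iff hV hKq (ℓ := c.ln) (ℓ' := d.ln)).1 ?_ hdisj
    rcases hx : col c.ln with P | π
    · rw [hx] at hc hd
      exact ⟨P, hc, hd⟩
    · rw [hx] at hc hd
      exact G.meet_iff.2 ⟨π, hc, hd⟩
  have hcard : Fintype.card (A ⊕ B) = q ^ 2 + q := by
    rw [Fintype.card_sum, Fintype.card_subtype, Fintype.card_subtype, G.card_points_off_line hm]
    congr 1
    convert G.card_other_planes hm
  exact hcard ▸ C.colorable

/-- In a colouring with fewer than `q ^ 2 + q` colours, extend each colour class to a maximal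
independent set. Those of the form `F x` leave too many lines uncovered for the other, small
classes. -/
lemma not_colorable (hV : finrank K V = 4) {q : ℕ} (hKq : Nat.card K = q) (hq : 47 ≤ q) {m : ℕ}
    (hm : m < q ^ 2 + q) : ¬ (chamberGraph K V).Colorable m := by
  rintro ⟨C⟩
  have : Finite V := Module.finite_of_finite K
  have _ := Fintype.ofFinite (Point K V)
  have _ := Fintype.ofFinite (Line K V)
  have _ := Fintype.ofFinite (Plane K V)
  have _ := Fintype.ofFinite (Chamber K V)
  have hext : ∀ i : Fin m, ∃ M : Set (Chamber K V), (∀ c, C c = i → c ∈ M) ∧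
      Maximal (chamberGraph K V).IsIndepSet M := by
    intro i
    obtain ⟨M, hle, hM⟩ := Finite.exists_le_maximal (p := (chamberGraph K V).IsIndepSet)
      (a := {c | C c = i}) fun c hc d hd _ hop => C.valid hop (hc.trans hd.symm)
    exact ⟨M, hle, hM⟩
  choose M hCM hM using hext
  set J : Finset (Fin m) :=
    {i | ¬ ∃ x : Submodule K V, (IsPoint x ∨ IsPlane x) ∧ M i = F x} with hJ
  have hbig : ∀ i, ∃ x : Submodule K V, i ∉ J → (IsPoint x ∨ IsPlane x) ∧ M i = F x := by
    intro i
    by_cases hi : i ∈ J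
    · exact ⟨⊥, fun h => absurd hi h⟩
    · have : ∃ x : Submodule K V, (IsPoint x ∨ IsPlane x) ∧ M i = F x := by
        by_contra hcon
        exact hi (mem_filter.2 ⟨mem_univ _, hcon⟩)
      obtain ⟨x, hx⟩ := this
      exact ⟨x, fun _ => hx⟩
  choose x hx using hbig
  set X : Finset (Submodule K V) := Jᶜ.image x with hX
  set A : Finset (Point K V) := {P | P.1 ∈ X} with hA
  set B : Finset (Plane K V) := {π | π.1 ∈ X} with hB
  have hAB : #A + #B + #J ≤ m := by
    have h1 : #A + #B ≤ #X := by
      rw [← card_map (Function.Embedding.subtype _), ← card_map (s := B)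
        (Function.Embedding.subtype _), ← card_union_of_disjoint]
      · refine card_le_card (union_subset ?_ ?_)
        · intro y hy
          obtain ⟨P, hP, rfl⟩ := mem_map.1 hy
          exact (mem_filter.1 hP).2
        · intro y hy
          obtain ⟨P, hP, rfl⟩ := mem_map.1 hy
          exact (mem_filter.1 hP).2
      · refine disjoint_left.2 fun y hy hy' => ?_
        obtain ⟨P, -, rfl⟩ := mem_map.1 hy
        obtain ⟨π, -, h⟩ := mem_map.1 hy'
        have hP : finrank K P.1 = 1 := P.2
        have hπ : finrank K π.1 = 3 := π.2
        have h : π.1 = P.1 := h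
        rw [h] at hπ
        omega
    have h2 : #X ≤ #Jᶜ := card_image_le
    have h3 := card_compl_add_card J
    rw [Fintype.card_fin] at h3
    omega
  obtain ⟨s, hs⟩ : ∃ s, #A + #B + s + 1 = q ^ 2 + q := ⟨q ^ 2 + q - 1 - (#A + #B), by omega⟩
  have hJs : #J ≤ s := by omega
  have hlt := (space hV hKq).lt_card_uncovered A B hq hs
  set U := (space hV hKq).uncovered A B
  -- the chambers on uncovered lines all have colours in `J`
  have hcover : ({c : Chamber K V | c.ln ∈ U} : Finset (Chamber K V)) ⊆
      J.biUnion fun i => (M i).toFinset := by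
    intro c hc
    have hcU := (space hV hKq).mem_uncovered.1 (mem_filter.1 hc).2
    have hcM := hCM (C c) c rfl
    by_cases hi : C c ∈ J
    · exact mem_biUnion.2 ⟨C c, hi, Set.mem_toFinset.2 hcM⟩
    obtain ⟨hx1, hx2⟩ := hx _ hi
    have hxX : x (C c) ∈ X := mem_image_of_mem x (mem_compl.2 hi)
    rw [hx2] at hcM
    rcases hx1 with hx1 | hx1
    · exact absurd ((incident_point hx1 c.isLine).1 hcM)
        (hcU.1 ⟨_, hx1⟩ (mem_filter.2 ⟨mem_univ _, hxX⟩))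
    · exact absurd ((incident_plane hx1 c.isLine).1 hcM)
        (hcU.2 ⟨_, hx1⟩ (mem_filter.2 ⟨mem_univ _, hxX⟩))
  have hsmall : ∀ i ∈ J, #(M i).toFinset ≤ 10 * q ^ 2 * (q + 1) := by
    intro i hi
    rw [← Set.ncard_eq_toFinset_card']
    exact ncard_le_of_maximal hV hKq (by omega) (hM i) (mem_filter.1 hi).2
  have h1 := (card_le_card hcover).trans (card_biUnion_le_card_mul _ _ _ hsmall)
  rw [card_chambers_on_lines hV hKq] at h1
  have h2 : #U * (q + 1) * (q + 1) ≤ 10 * q ^ 2 * s * (q + 1) := by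
    calc #U * (q + 1) * (q + 1) = #U * (q + 1) ^ 2 := by ring
      _ ≤ #J * (10 * q ^ 2 * (q + 1)) := h1
      _ ≤ s * (10 * q ^ 2 * (q + 1)) := Nat.mul_le_mul_right _ hJs
      _ = 10 * q ^ 2 * s * (q + 1) := by ring
  exact absurd (Nat.le_of_mul_le_mul_right h2 (Nat.succ_pos q)) (not_le.2 hlt)

end Chambers

end PG3

theorem theorem1 {K V : Type*} [Field K] [Finite K] [AddCommGroup V] [Module K V]
    [Module.Finite K V] (hV : Module.finrank K V = 4)
    (q : ℕ) (hKq : Nat.card K = q) (hq : 43 ≤ q) :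
    (∀ S : Finset (PG3.Chamber K V),
      (PG3.chamberGraph K V).IsMaximumIndepSet S ↔
        ∃ x : Submodule K V, (PG3.IsPoint x ∨ PG3.IsPlane x) ∧
          (S : Set (PG3.Chamber K V)) = PG3.F x) ∧
    (∀ S : Set (PG3.Chamber K V),
      Maximal (PG3.chamberGraph K V).IsIndepSet S →
      (¬ ∃ x : Submodule K V, (PG3.IsPoint x ∨ PG3.IsPlane x) ∧ S = PG3.F x) →
      S.ncard ≤ 9 * (q + 1) * (5 * q ^ 2 + 1)) ∧
    (47 ≤ q → (PG3.chamberGraph K V).chromaticNumber = ((q ^ 2 + q : ℕ) : ℕ∞)) := by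
  have hlt : 10 * q ^ 2 * (q + 1) < (q ^ 2 + q + 1) * (q + 1) ^ 2 := by
    have : 10 * q ^ 2 < (q ^ 2 + q + 1) * (q + 1) := by nlinarith [Nat.zero_le (q ^ 2)]
    calc 10 * q ^ 2 * (q + 1) < (q ^ 2 + q + 1) * (q + 1) * (q + 1) :=
          Nat.mul_lt_mul_of_pos_right this (Nat.succ_pos q)
      _ = (q ^ 2 + q + 1) * (q + 1) ^ 2 := by ring
  refine ⟨fun S => ⟨fun hS => ?_, ?_⟩, fun S hS hF => ?_, fun hq' => ?_⟩
  · by_contra hF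
    obtain ⟨x, hx, -⟩ := PG3.exists_isPoint_le (K := K) (X := (⊤ : Submodule K V)) <| by
      intro h
      rw [← finrank_top K V, h, finrank_bot] at hV
      omega
    have h1 := PG3.ncard_le_of_maximal hV hKq hq hS.isMaximalIndepSet hF
    have h2 := hS.maximum (Set.toFinite (PG3.F x)).toFinset
      (by simpa using PG3.isIndepSet_F hV (Or.inl hx))
    rw [← Set.ncard_eq_toFinset_card, PG3.ncard_F hV hKq (Or.inl hx)] at h2
    rw [Set.ncard_coe_finset] at h1
    omega
  · rintro ⟨x, hx, hSx⟩
    refine ⟨hSx ▸ PG3.isIndepSet_F hV hx, fun t ht => ?_⟩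
    obtain ⟨M, htM, hM⟩ := Finite.exists_le_maximal ht
    rw [← Set.ncard_coe_finset S, hSx, PG3.ncard_F hV hKq hx, ← Set.ncard_coe_finset t]
    refine (Set.ncard_le_ncard htM).trans ?_
    by_cases hF : ∃ y : Submodule K V, (PG3.IsPoint y ∨ PG3.IsPlane y) ∧ M = PG3.F y
    · obtain ⟨y, hy, rfl⟩ := hF
      exact (PG3.ncard_F hV hKq hy).le
    · exact (PG3.ncard_le_of_maximal hV hKq hq hM hF).trans hlt.le
  · refine (PG3.ncard_le_of_maximal hV hKq hq hS hF).trans ?_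
    nlinarith [Nat.zero_le (q ^ 3), Nat.zero_le (q ^ 2)]
  · refine le_antisymm (PG3.colorable hV hKq).chromaticNumber_le ?_
    refine SimpleGraph.le_chromaticNumber_iff_colorable.2 fun m hm => ?_
    by_contra hcon
    exact PG3.not_colorable hV hKq hq' (by exact_mod_cast not_le.1 hcon) hm
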